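/- Let $\alpha>-1/2$, let $1<p\le q<\infty$, $1/p+1/p'=1$, and let $\beta,\gamma\in\mathbb R$. Norms are $\|g\|_p=\big(\int_0^\infty|g(x)|^p\,dx\big)^{1/p}\in[0,\infty]$. For $x>0$ let $$\mathbf H_\alpha(x)=\Big(\frac x2\Big)^{\alpha+1}\sum_{k=0}^\infty\frac{(-1)^k(x/2)^{2k}}{\Gamma(k+3/2)\,\Gamma(k+\alpha+3/2)}$$ be the Struve function, and for $f:(0,\infty)\to\mathbb C$ let $$\mathscr H_\alpha f(y)=\int_0^\infty (xy)^{1/2}f(x)\,\mathbf H_\alpha(xy)\,dx=\lim_{R\to\infty}\int_0^R (xy)^{1/2}f(x)\,\mathbf H_\alpha(xy)\,dx,\qquad y>0 .$$ For $C,\lambda>1$ let $GM(C,\lambda)$ be the set of functions $f:(0,\infty)\to\mathbb C$ that are locally of bounded variation and satisfy $$\int_x^{2x}|df(t)|\le\frac Cx\int_{x/\lambda}^{\lambda x}|f(t)|\,dt\qquad\text{for all }x>0,$$ where the left-hand side is the total variation of $f$ on $[x,2x]$, and let $GM=\bigcup_{C,\lambda>1}GM(C,\lambda)$. Call $f\in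 GM$ admissible if $$\int_0^1x^{\alpha+3/2}|f(x)|\,dx+\int_1^\infty x^{\alpha-1/2}|f(x)|\,dx<\infty .$$ For every admissible $f\in GM$ and every $y>0$, the integrals over $(0,R)$ above converge absolutely and their limit as $R\to\infty$ exists, so that $\mathscr H_\alpha f$ is defined on $(0,\infty)$. Moreover, the inequality $$\|y^{-\beta}\mathscr H_\alpha f\|_q\lesssim\|x^{\gamma}f\|_p$$ holds for admissible general monotone functions, meaning that for all $C,\lambda>1$ there is a constant $A<\infty$ with $\|y^{-\beta}\mathscr H_\alpha f\|_q\le A\,\|x^\gamma f\|_p$ for every admissible $f\in GM(C,\lambda)$, if and only if $$\beta=\gamma+\frac1q-\frac1{p'}\qquad\text{and}\qquad\frac1q+\alpha-\frac12<\beta<\frac1q+\alpha+\frac32 .$$ -/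

import Mathlib

open Set Filter Topology MeasureTheory
open scoped NNReal ENNReal

/-- The Struve function `𝐇_α(x)`, `x > 0`, given by its power series. -/
noncomputable def struveH (α x : ℝ) : ℝ :=
  (x / 2) ^ (α + 1) *
    ∑' k : ℕ, (-1 : ℝ) ^ k * (x / 2) ^ (2 * k) /
      (Real.Gamma ((k : ℝ) + 3 / 2) * Real.Gamma ((k : ℝ) + α + 3 / 2))

/-- The integrand `(xy)^{1/2} f(x) 𝐇_α(xy)` of the `ℋ_α` transform. -/
noncomputable def struveIntegrand (α : ℝ) (f : ℝ → ℂ) (y x : ℝ) : ℂ :=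
  (((x * y) ^ (1 / 2 : ℝ) : ℝ) : ℂ) * f x * ((struveH α (x * y) : ℝ) : ℂ)

/-- The integral `∫_0^∞ (xy)^{1/2} f(x) 𝐇_α(xy) dx` makes sense: the integrand is integrable on
every `(0, R]`, and the integrals over `(0, R]` converge as `R → ∞`. (For `α < 1/2` the integral of
an admissible general monotone function need not converge absolutely at infinity.) -/
def StruveConverges (α : ℝ) (f : ℝ → ℂ) (y : ℝ) : Prop :=
  (∀ R : ℝ, 0 < R → IntegrableOn (struveIntegrand α f y) (Ioc 0 R)) ∧
    ∃ l : ℂ, Tendsto (fun R : ℝ => ∫ x in Ioc 0 R, struveIntegrand α f y x) atTop (𝓝 l)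

/-- The transform `ℋ_α f(y) = ∫_0^∞ (xy)^{1/2} f(x) 𝐇_α(xy) dx = lim_{R → ∞} ∫_0^R …`. -/
noncomputable def struveTransform (α : ℝ) (f : ℝ → ℂ) (y : ℝ) : ℂ :=
  limUnder atTop (fun R : ℝ => ∫ x in Ioc 0 R, struveIntegrand α f y x)

/-- `f : (0, ∞) → ℂ` is general monotone with constants `C` and `lam`: it is locally of bounded
variation and `∫_x^{2x} |df(t)| ≤ (C / x) ∫_{x/lam}^{lam x} |f(t)| dt` for all `x > 0`. The Stieltjes
integral on the left is the total variation of `f` on `[x, 2x]`. -/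
def GMWith (C lam : ℝ) (f : ℝ → ℂ) : Prop :=
  LocallyBoundedVariationOn f (Ioi 0) ∧
    ∀ x : ℝ, 0 < x →
      eVariationOn f (Icc x (2 * x)) ≤
        ENNReal.ofReal (C / x * ∫ t in Icc (x / lam) (lam * x), ‖f t‖)

/-- The class `GM` of general monotone functions. -/
def IsGM (f : ℝ → ℂ) : Prop :=
  ∃ C lam : ℝ, 1 < C ∧ 1 < lam ∧ GMWith C lam f

/-- Admissibility with parameters `b₀, b₁, b`:
`∫_0^1 x^{b₀+b₁} |f(x)| dx + ∫_1^∞ x^{b-1} |f(x)| dx < ∞`. -/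
def IsAdmissible (b₀ b₁ b : ℝ) (f : ℝ → ℂ) : Prop :=
  IntegrableOn (fun x : ℝ => x ^ (b₀ + b₁) * ‖f x‖) (Ioc 0 1) ∧
    IntegrableOn (fun x : ℝ => x ^ (b - 1) * ‖f x‖) (Ioi 1)

/-- Admissibility for the `ℋ_α` transform: `b₀ = 1/2`, `b₁ = α + 1`, `b = α + 1/2`. -/
def StruveAdmissible (α : ℝ) (f : ℝ → ℂ) : Prop :=
  IsAdmissible (1 / 2) (α + 1) (α + 1 / 2) f

/-- The (extended) norm `‖x^s g(x)‖_p` in `L^p(0, ∞)`. -/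
noncomputable def powerNorm (p s : ℝ) (g : ℝ → ℂ) : ℝ≥0∞ :=
  eLpNorm (fun x : ℝ => ((x ^ s : ℝ) : ℂ) * g x) (ENNReal.ofReal p) (volume.restrict (Ioi 0))

/-!
On general monotone functions the transform `ℋ_α` is dominated by a positive integral operator whose
kernel depends on `xy` only, and the conditions on `β` and `γ` are those under which that operator is
bounded. They are necessary because truncated powers have transforms of the full size of this bound.

**The kernel.** Write `K(t) = t ^ (1 / 2) 𝐇_α(t)`. Near `0` the power series gives
`K(t) = O(t ^ (α + 3 / 2))`. At infinity `K` contains, besides a term of the order of `t ^ (α - 1 / 2)`,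
an oscillating term of order `1`, which dominates for `α < 1 / 2`. Its integrals are nevertheless
as small as if it were absent: `|∫_A^B K| ≤ C B ^ (α + 1 / 2)`
(`exists_abs_integral_struveKernel_le`). The reason is that `W(t) = t ^ (α + 1) 𝐇_{α+1}(t)` is a
primitive of `t ^ (α + 1) 𝐇_α(t)` (`hasDerivAt_struvePrimitive`), and that the order `α + 1` exceeds
`1 / 2`, so that Poisson's integral for `𝐇_{α+1}` can be integrated by parts and yields
`W(t) = O(t ^ (2 α + 1))` (`exists_abs_struvePrimitive_le`).

**Sufficiency.** Summation by parts (`norm_integral_sub_mul_le`) bounds the integral of `f(x) K(xy)`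
over a dyadic block by the size and the variation of `f` there, hence, for a general monotone `f`, by
the mean of `|f|` over a larger block (`GMWith.norm_integral_mul_le`). Summed over the dyadic blocks
this gives the convergence of the transform (`GMWith.struveConverges`) and the pointwise bound
`|ℋ_α f(y)| ≤ D ∫_0^∞ k(xy) |f(x)| dx` with `k(t) = min (t ^ (α + 3 / 2)) (t ^ (α - 1 / 2))`
(`exists_norm_struveTransform_le`). With respect to `dx / x` the weighted operator is a multiplicative
convolution with `t ^ (1 / q - β) k(t)`, which is bounded and integrable for `dt / t` under the
conditions on `β`; a Schur test for `p ≤ q` (`lintegral_schur_rpow_le`) concludes.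

**Necessity.** The functions `x ^ (α + 1 / 2)` cut off to `(r, 2r]` are general monotone with constants
independent of `r`, and their transforms are `y ^ (-α - 3 / 2) (W(2ry) - W(ry))`
(`struveTransform_cutPower`). Letting `r` range over `(0, ∞)` forces the relation between `β` and `γ`
by homogeneity. For `r = 1` the increment of `W` is at least of the order of `y ^ (2 α + 3)` at `0` and
of `y ^ (2 α + 1)` at infinity (by the Riemann–Lebesgue lemma in Poisson's integral), and the finiteness
of the norm near `0` and near infinity gives the two inequalities for `β`.
-/

/-! ### The power series of the Struve function -/

/-- The power series `F_ν(z) = ∑ (-1)^k z^k / (Γ(k + 3/2) Γ(k + ν + 3/2))`, for which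
`𝐇_ν(x) = (x / 2) ^ (ν + 1) * F_ν ((x / 2) ^ 2)`. -/
noncomputable def struveSeries (ν z : ℝ) : ℝ :=
  ∑' k : ℕ, (-1 : ℝ) ^ k * z ^ k / (Real.Gamma ((k : ℝ) + 3 / 2) * Real.Gamma ((k : ℝ) + ν + 3 / 2))

theorem struveH_eq_struveSeries (ν x : ℝ) :
    struveH ν x = (x / 2) ^ (ν + 1) * struveSeries ν ((x / 2) ^ 2) := by
  simp only [struveH, struveSeries, pow_mul]

theorem factorial_mul_Gamma_le {s : ℝ} (hs : 1 ≤ s) (k : ℕ) :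
    (k.factorial : ℝ) * Real.Gamma s ≤ Real.Gamma (k + s) := by
  induction k with
  | zero => simp
  | succ k ih =>
    have h1 : ((k + 1 : ℕ) : ℝ) + s = (k + s) + 1 := by push_cast; ring
    have h0 : 0 < (k : ℝ) + s := by positivity
    have hG : 0 < Real.Gamma s := Real.Gamma_pos_of_pos (by linarith)
    rw [h1, Real.Gamma_add_one h0.ne', Nat.factorial_succ]
    push_cast
    calc ((k : ℝ) + 1) * k.factorial * Real.Gamma s
        = ((k : ℝ) + 1) * (k.factorial * Real.Gamma s) := by ring
      _ ≤ (k + s) * Real.Gamma (k + s) := by gcongr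

theorem norm_struveSeries_term_le {ν : ℝ} (hν : -1 / 2 < ν) {z R : ℝ} (hz : |z| ≤ R) (k : ℕ) :
    ‖(-1 : ℝ) ^ k * z ^ k /
      (Real.Gamma ((k : ℝ) + 3 / 2) * Real.Gamma ((k : ℝ) + ν + 3 / 2))‖ ≤
      (Real.Gamma (3 / 2) * Real.Gamma (ν + 3 / 2))⁻¹ * (R ^ k / k.factorial) := by
  have hR : 0 ≤ R := (abs_nonneg z).trans hz
  have h1 : (k.factorial : ℝ) * Real.Gamma (3 / 2) ≤ Real.Gamma (k + 3 / 2) :=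
    factorial_mul_Gamma_le (by norm_num) k
  have h2 : (k.factorial : ℝ) * Real.Gamma (ν + 3 / 2) ≤ Real.Gamma (k + ν + 3 / 2) := by
    rw [add_assoc]; exact factorial_mul_Gamma_le (by linarith) k
  have g1 : 0 < Real.Gamma (3 / 2) := Real.Gamma_pos_of_pos (by norm_num)
  have g2 : 0 < Real.Gamma (ν + 3 / 2) := Real.Gamma_pos_of_pos (by linarith)
  have hk : (1 : ℝ) ≤ k.factorial := by exact_mod_cast Nat.succ_le_of_lt k.factorial_pos
  have g3 : 0 < Real.Gamma (k + 3 / 2) := lt_of_lt_of_le (by positivity) h1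
  have g4 : 0 < Real.Gamma (k + ν + 3 / 2) := lt_of_lt_of_le (by positivity) h2
  rw [norm_div, norm_mul, norm_pow, norm_neg, norm_one, one_pow, one_mul, norm_pow,
    Real.norm_eq_abs, Real.norm_of_nonneg (by positivity)]
  rw [inv_mul_eq_div, div_div]
  refine div_le_div₀ (by positivity) (by gcongr) (by positivity) ?_
  calc (k.factorial : ℝ) * (Real.Gamma (3 / 2) * Real.Gamma (ν + 3 / 2))
      = ((k.factorial : ℝ) * Real.Gamma (3 / 2)) * (1 * Real.Gamma (ν + 3 / 2)) := by ring
    _ ≤ Real.Gamma (k + 3 / 2) * ((k.factorial : ℝ) * Real.Gamma (ν + 3 / 2)) := by gcongr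
    _ ≤ _ := by gcongr

theorem summable_struveSeries_bound (ν R : ℝ) :
    Summable fun k : ℕ => (Real.Gamma (3 / 2) * Real.Gamma (ν + 3 / 2))⁻¹ *
      (R ^ k / k.factorial) :=
  (Real.summable_pow_div_factorial R).mul_left _

theorem hasSum_struveSeries {ν : ℝ} (hν : -1 / 2 < ν) (z : ℝ) :
    HasSum (fun k : ℕ => (-1 : ℝ) ^ k * z ^ k /
      (Real.Gamma ((k : ℝ) + 3 / 2) * Real.Gamma ((k : ℝ) + ν + 3 / 2))) (struveSeries ν z) :=
  (Summable.of_norm_bounded (summable_struveSeries_bound ν |z|)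
    fun k => norm_struveSeries_term_le hν le_rfl k).hasSum

theorem continuous_struveSeries {ν : ℝ} (hν : -1 / 2 < ν) : Continuous (struveSeries ν) := by
  refine continuous_iff_continuousAt.2 fun z => ?_
  have h : ContinuousOn (struveSeries ν) (Icc (-(|z| + 1)) (|z| + 1)) :=
    continuousOn_tsum (fun k => by fun_prop) (summable_struveSeries_bound ν (|z| + 1))
      fun k x hx => norm_struveSeries_term_le hν (abs_le.2 hx) k
  refine h.continuousAt (Icc_mem_nhds ?_ ?_)
  · linarith [neg_abs_le z]
  · linarith [le_abs_self z]

theorem struveSeries_zero_pos {ν : ℝ} (hν : -1 / 2 < ν) : 0 < struveSeries ν 0 := by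
  have h := (hasSum_struveSeries hν 0).unique (hasSum_single 0 fun k hk => by simp [hk])
  rw [h]
  have g1 : 0 < Real.Gamma (3 / 2) := Real.Gamma_pos_of_pos (by norm_num)
  have g2 : 0 < Real.Gamma (ν + 3 / 2) := Real.Gamma_pos_of_pos (by linarith)
  simp only [Nat.cast_zero, pow_zero, zero_add, mul_one]
  positivity

theorem continuousOn_struveH {ν : ℝ} (hν : -1 / 2 < ν) : ContinuousOn (struveH ν) (Ioi 0) := by
  have h : ContinuousOn (fun x : ℝ => (x / 2) ^ (ν + 1) * struveSeries ν ((x / 2) ^ 2)) (Ioi 0) := by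
    refine ContinuousOn.mul (ContinuousOn.rpow_const (by fun_prop) fun x hx => Or.inl ?_)
      ((continuous_struveSeries hν).comp (by fun_prop)).continuousOn
    have : (0 : ℝ) < x := hx
    positivity
  exact h.congr fun x _ => struveH_eq_struveSeries ν x

/-- Termwise integration of the series of `F_ν`, using `Γ(s + 1) = s Γ(s)`. -/
theorem integral_rpow_mul_struveSeries {ν : ℝ} (hν : -1 / 2 < ν) {z : ℝ} (hz : 0 < z) :
    ∫ w in (0 : ℝ)..z, w ^ (ν + 1 / 2) * struveSeries ν w =
      z ^ (ν + 3 / 2) * struveSeries (ν + 1) z := by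
  let f : ℕ → C(ℝ, ℝ) := fun k =>
    ⟨fun w => w ^ (ν + 1 / 2) * ((-1 : ℝ) ^ k * w ^ k /
      (Real.Gamma ((k : ℝ) + 3 / 2) * Real.Gamma ((k : ℝ) + ν + 3 / 2))),
      (Real.continuous_rpow_const (by linarith)).mul (by fun_prop)⟩
  have hs : Summable fun k => ‖(f k).restrict (⟨uIcc 0 z, isCompact_uIcc⟩ :
      TopologicalSpace.Compacts ℝ)‖ := by
    refine Summable.of_nonneg_of_le (fun k => norm_nonneg _) (fun k => ?_)
      ((summable_struveSeries_bound ν z).mul_left (z ^ (ν + 1 / 2)))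
    have hb : 0 ≤ z ^ (ν + 1 / 2) * ((Real.Gamma (3 / 2) * Real.Gamma (ν + 3 / 2))⁻¹ *
        (z ^ k / k.factorial)) := by
      have g1 : 0 < Real.Gamma (3 / 2) := Real.Gamma_pos_of_pos (by norm_num)
      have g2 : 0 < Real.Gamma (ν + 3 / 2) := Real.Gamma_pos_of_pos (by linarith)
      positivity
    rw [ContinuousMap.norm_le _ hb]
    rintro ⟨w, hw⟩
    have hw' : w ∈ Icc 0 z := by simpa [uIcc_of_le hz.le] using hw
    change ‖w ^ (ν + 1 / 2) * _‖ ≤ _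
    rw [norm_mul, Real.norm_of_nonneg (Real.rpow_nonneg hw'.1 _)]
    gcongr
    · exact hw'.1
    · linarith
    · exact hw'.2
    · exact norm_struveSeries_term_le hν (abs_le.2 ⟨by linarith [hw'.1], hw'.2⟩) k
  have h1 := intervalIntegral.hasSum_intervalIntegral_of_summable_norm hs
  have h2 : ∀ w : ℝ, ∑' k, f k w = w ^ (ν + 1 / 2) * struveSeries ν w := fun w => by
    simp only [f, ContinuousMap.coe_mk, struveSeries, tsum_mul_left]
  simp only [h2] at h1
  refine h1.unique ?_
  convert! (hasSum_struveSeries (ν := ν + 1) (by linarith) z).mul_left (z ^ (ν + 3 / 2)) using 2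
    with k
  have e : ∀ w ∈ uIcc 0 z, f k w = (-1 : ℝ) ^ k /
      (Real.Gamma ((k : ℝ) + 3 / 2) * Real.Gamma ((k : ℝ) + ν + 3 / 2)) * w ^ (k + ν + 1 / 2) := by
    intro w hw
    have hw' : w ∈ Icc 0 z := by simpa [uIcc_of_le hz.le] using hw
    have : w ^ (k + ν + 1 / 2) = w ^ k * w ^ (ν + 1 / 2) := by
      rw [add_assoc, Real.rpow_add_of_nonneg hw'.1 (by positivity) (by linarith),
        Real.rpow_natCast]
    rw [this]
    simp only [f, ContinuousMap.coe_mk]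
    ring
  rw [intervalIntegral.integral_congr e, intervalIntegral.integral_const_mul,
    integral_rpow (Or.inl (by have : (0 : ℝ) ≤ k := by positivity
                              linarith))]
  have h0 : (0 : ℝ) < k + ν + 3 / 2 := by have : (0 : ℝ) ≤ k := by positivity
                                          linarith
  have e1 : (k : ℝ) + (ν + 1) + 3 / 2 = (k + ν + 3 / 2) + 1 := by ring
  have e2 : (k : ℝ) + ν + 1 / 2 + 1 = k + ν + 3 / 2 := by ring
  have e3 : z ^ ((k : ℝ) + ν + 3 / 2) = z ^ (ν + 3 / 2) * z ^ k := by
    rw [add_assoc, add_comm, Real.rpow_add hz, Real.rpow_natCast]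
  rw [e1, Real.Gamma_add_one h0.ne', e2, Real.zero_rpow h0.ne', e3]
  have g1 : Real.Gamma ((k : ℝ) + 3 / 2) ≠ 0 := (Real.Gamma_pos_of_pos (by positivity)).ne'
  have g2 : Real.Gamma ((k : ℝ) + ν + 3 / 2) ≠ 0 := (Real.Gamma_pos_of_pos h0).ne'
  field_simp
  ring

/-- The function `W(t) = t ^ (α + 1) 𝐇_{α+1}(t)`, a primitive of `t ^ (α + 1) 𝐇_α(t)`. -/
noncomputable def struvePrimitive (α t : ℝ) : ℝ := t ^ (α + 1) * struveH (α + 1) t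

theorem struvePrimitive_eq (α : ℝ) {t : ℝ} (ht : 0 < t) :
    struvePrimitive α t =
      2 ^ (α + 1) * (((t / 2) ^ 2) ^ (α + 3 / 2) * struveSeries (α + 1) ((t / 2) ^ 2)) := by
  have h2 : (0 : ℝ) < t / 2 := by positivity
  have e1 : ((t / 2) ^ 2) ^ (α + 3 / 2) = (t / 2) ^ (α + 1) * (t / 2) ^ (α + 1 + 1) := by
    rw [← Real.rpow_natCast, ← Real.rpow_mul h2.le, ← Real.rpow_add h2]
    congr 1; push_cast; ring
  have e2 : t ^ (α + 1) = 2 ^ (α + 1) * (t / 2) ^ (α + 1) := by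
    rw [← Real.mul_rpow (by norm_num) h2.le]; congr 1; ring
  rw [struvePrimitive, struveH_eq_struveSeries, e1, e2]
  ring

theorem hasDerivAt_struvePrimitive {α : ℝ} (hα : -1 / 2 < α) {t : ℝ} (ht : 0 < t) :
    HasDerivAt (struvePrimitive α) (t ^ (α + 1) * struveH α t) t := by
  have h2 : (0 : ℝ) < t / 2 := by positivity
  have hc : Continuous fun w : ℝ => w ^ (α + 1 / 2) * struveSeries α w :=
    (Real.continuous_rpow_const (by linarith)).mul (continuous_struveSeries hα)
  have h1 := intervalIntegral.integral_hasDerivAt_right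
    (hc.intervalIntegrable 0 ((t / 2) ^ 2)) hc.aestronglyMeasurable.stronglyMeasurableAtFilter
    hc.continuousAt
  have h3 : HasDerivAt (fun t : ℝ => (t / 2) ^ 2) (t / 2) t := by
    have := ((hasDerivAt_id t).div_const 2).pow 2
    convert! this using 1
    simp; ring
  have h4 := (h1.comp t h3).const_mul ((2 : ℝ) ^ (α + 1))
  have h5 := h4.congr_of_eventuallyEq (f₁ := struvePrimitive α) (by
    filter_upwards [lt_mem_nhds ht] with s hs
    rw [struvePrimitive_eq α hs]
    simp only [Function.comp]
    rw [integral_rpow_mul_struveSeries hα (by positivity)])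
  convert! h5 using 1
  have e1 : ((t / 2) ^ 2) ^ (α + 1 / 2) * (t / 2) = (t / 2) ^ (α + 1) * (t / 2) ^ (α + 1) := by
    rw [← Real.rpow_natCast (t / 2) 2, ← Real.rpow_mul h2.le, ← Real.rpow_add_one h2.ne',
      ← Real.rpow_add h2]
    congr 1; push_cast; ring
  have e2 : t ^ (α + 1) = 2 ^ (α + 1) * (t / 2) ^ (α + 1) := by
    rw [← Real.mul_rpow (by norm_num) h2.le]; congr 1; ring
  rw [struveH_eq_struveSeries, e2]
  linear_combination (-(2 ^ (α + 1) * struveSeries α ((t / 2) ^ 2))) * e1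

/-! ### The Poisson integral of the Struve function and its asymptotics -/

theorem hasDerivAt_one_sub_sq_rpow {μ x : ℝ} (h : 1 - x ^ 2 ≠ 0 ∨ 1 ≤ μ) :
    HasDerivAt (fun u : ℝ => (1 - u ^ 2) ^ μ) (-(2 * μ * x * (1 - x ^ 2) ^ (μ - 1))) x := by
  have h1 : HasDerivAt (fun u : ℝ => 1 - u ^ 2) (-(2 * x)) x := by
    simpa using ((hasDerivAt_id x).pow 2).const_sub 1
  convert! h1.rpow_const h using 1
  ring

theorem continuous_one_sub_sq_rpow {μ : ℝ} (hμ : 0 ≤ μ) :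
    Continuous fun u : ℝ => (1 - u ^ 2) ^ μ :=
  Continuous.rpow_const (by fun_prop) fun _ => Or.inr hμ

/-- The moments of `(1 - u²) ^ μ`, by induction on `k`: an integration by parts lowers `k` and
raises `μ`. -/
theorem integral_pow_mul_one_sub_sq_rpow (k : ℕ) : ∀ {μ : ℝ}, 0 < μ →
    ∫ u in (0 : ℝ)..1, u ^ (2 * k + 1) * (1 - u ^ 2) ^ μ =
      k.factorial * Real.Gamma (μ + 1) / (2 * Real.Gamma (μ + k + 2)) := by
  have hv : ∀ {μ : ℝ}, 0 < μ → ∀ x : ℝ,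
      HasDerivAt (fun u : ℝ => -(1 - u ^ 2) ^ (μ + 1) / (2 * (μ + 1))) (x * (1 - x ^ 2) ^ μ) x := by
    intro μ hμ x
    convert! (hasDerivAt_one_sub_sq_rpow (μ := μ + 1) (x := x)
      (Or.inr (by linarith))).neg.div_const (2 * (μ + 1)) using 1
    have : μ + 1 ≠ 0 := by positivity
    rw [add_sub_cancel_right]
    field_simp
  have hi : ∀ {μ : ℝ}, 0 < μ →
      IntervalIntegrable (fun x : ℝ => x * (1 - x ^ 2) ^ μ) volume 0 1 := fun hμ =>
    (continuous_id.mul (continuous_one_sub_sq_rpow hμ.le)).intervalIntegrable _ _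
  induction k with
  | zero =>
    intro μ hμ
    have h := intervalIntegral.integral_eq_sub_of_hasDerivAt (fun x _ => hv hμ x) (hi hμ)
    have hG : Real.Gamma (μ + 2) = (μ + 1) * Real.Gamma (μ + 1) := by
      rw [← Real.Gamma_add_one (by positivity)]; congr 1; ring
    have hp : Real.Gamma (μ + 1) ≠ 0 := (Real.Gamma_pos_of_pos (by positivity)).ne'
    have hm : μ + 1 ≠ 0 := by positivity
    simp only [mul_zero, zero_add, pow_one, Nat.factorial_zero, Nat.cast_one, Nat.cast_zero,
      add_zero, one_mul]
    rw [h, hG]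
    simp [Real.zero_rpow hm]
    field_simp
  | succ k ih =>
    intro μ hμ
    have hu : ∀ x : ℝ, HasDerivAt (fun u : ℝ => u ^ (2 * k + 2)) ((2 * k + 2) * x ^ (2 * k + 1)) x :=
      fun x => by simpa using hasDerivAt_pow (2 * k + 2) x
    have h := intervalIntegral.integral_mul_deriv_eq_deriv_mul (a := 0) (b := 1)
      (fun x _ => hu x) (fun x _ => hv hμ x)
      ((by fun_prop : Continuous fun x : ℝ => (2 * (k : ℝ) + 2) * x ^ (2 * k + 1)).intervalIntegrable
        _ _) (hi hμ)
    have e1 : ∀ u : ℝ, u ^ (2 * (k + 1) + 1) * (1 - u ^ 2) ^ μ =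
        u ^ (2 * k + 2) * (u * (1 - u ^ 2) ^ μ) := fun u => by ring
    have hm : μ + 1 ≠ 0 := by positivity
    have e2 : ∀ u : ℝ, (2 * k + 2) * u ^ (2 * k + 1) * (-(1 - u ^ 2) ^ (μ + 1) / (2 * (μ + 1))) =
        (-(k + 1) / (μ + 1)) * (u ^ (2 * k + 1) * (1 - u ^ 2) ^ (μ + 1)) := fun u => by
      field_simp
    have hG : Real.Gamma (μ + 1 + 1) = (μ + 1) * Real.Gamma (μ + 1) := Real.Gamma_add_one hm
    simp only [e1, e2] at h ⊢
    rw [h, intervalIntegral.integral_const_mul, ih (by positivity), hG]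
    have e3 : μ + 1 + k + 2 = μ + ((k + 1 : ℕ) : ℝ) + 2 := by push_cast; ring
    have hp : Real.Gamma (μ + ((k + 1 : ℕ) : ℝ) + 2) ≠ 0 :=
      (Real.Gamma_pos_of_pos (by positivity)).ne'
    rw [e3, Nat.factorial_succ]
    simp [Real.zero_rpow hm]
    push_cast at hp
    field_simp
    ring

/-- The duplication formula for `Γ` at positive integers. -/
theorem factorial_mul_Gamma_add_three_halves (k : ℕ) :
    (k.factorial : ℝ) * Real.Gamma (k + 3 / 2) =
      (2 * k + 1).factorial * √Real.pi / 2 ^ (2 * k + 1) := by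
  have h := Real.Gamma_mul_Gamma_add_half ((k : ℝ) + 1)
  rw [Real.Gamma_nat_eq_factorial] at h
  have e1 : (k : ℝ) + 1 + 1 / 2 = k + 3 / 2 := by ring
  have e2 : 2 * ((k : ℝ) + 1) = ((2 * k + 1 : ℕ) : ℝ) + 1 := by push_cast; ring
  have e3 : (1 : ℝ) - (((2 * k + 1 : ℕ) : ℝ) + 1) = -((2 * k + 1 : ℕ) : ℝ) := by ring
  rw [e1, e2, Real.Gamma_nat_eq_factorial, e3, Real.rpow_neg (by norm_num), Real.rpow_natCast] at h
  rw [h]; ring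

/-- **Poisson's integral** for the Struve function of order `μ + 1 / 2 > 1 / 2`. -/
theorem integral_one_sub_sq_rpow_mul_sin {μ : ℝ} (hμ : 0 < μ) (x : ℝ) :
    ∫ u in (0 : ℝ)..1, (1 - u ^ 2) ^ μ * Real.sin (x * u) =
      √Real.pi * Real.Gamma (μ + 1) / 2 * ((x / 2) * struveSeries (μ + 1 / 2) ((x / 2) ^ 2)) := by
  let f : ℕ → C(ℝ, ℝ) := fun k =>
    ⟨fun u => (1 - u ^ 2) ^ μ * ((-1) ^ k * (x * u) ^ (2 * k + 1) / (2 * k + 1).factorial),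
      (continuous_one_sub_sq_rpow hμ.le).mul (by fun_prop)⟩
  have hs : Summable fun k => ‖(f k).restrict (⟨uIcc 0 1, isCompact_uIcc⟩ :
      TopologicalSpace.Compacts ℝ)‖ := by
    have hb : Summable fun k : ℕ => |x| ^ (2 * k + 1) / (2 * k + 1).factorial :=
      (Real.summable_pow_div_factorial |x|).comp_injective (i := fun k : ℕ => 2 * k + 1)
        fun a b h => by simpa using h
    refine Summable.of_nonneg_of_le (fun k => norm_nonneg _) (fun k => ?_) hb
    rw [ContinuousMap.norm_le _ (by positivity)]
    rintro ⟨u, hu⟩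
    have hu' : u ∈ Icc (0 : ℝ) 1 := by simpa using hu
    have h1 : 0 ≤ 1 - u ^ 2 := by nlinarith [hu'.1, hu'.2]
    change ‖(1 - u ^ 2) ^ μ * _‖ ≤ _
    rw [norm_mul, Real.norm_of_nonneg (Real.rpow_nonneg h1 _), norm_div, norm_mul, norm_pow,
      norm_neg, norm_one, one_pow, one_mul, norm_pow, norm_mul, Real.norm_of_nonneg hu'.1,
      Real.norm_natCast, Real.norm_eq_abs]
    have h2 : (1 - u ^ 2) ^ μ ≤ 1 := Real.rpow_le_one h1 (by nlinarith [hu'.1]) hμ.le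
    calc (1 - u ^ 2) ^ μ * ((|x| * u) ^ (2 * k + 1) / (2 * k + 1).factorial)
        ≤ 1 * ((|x| * 1) ^ (2 * k + 1) / (2 * k + 1).factorial) := by
          have := hu'.1
          gcongr
          exact hu'.2
      _ = _ := by simp
  have h1 := intervalIntegral.hasSum_intervalIntegral_of_summable_norm hs
  have h2 : ∀ u : ℝ, ∑' k, f k u = (1 - u ^ 2) ^ μ * Real.sin (x * u) := fun u => by
    simp only [f, ContinuousMap.coe_mk, tsum_mul_left]
    rw [(Real.hasSum_sin (x * u)).tsum_eq]
  simp only [h2] at h1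
  refine h1.unique ?_
  convert! ((hasSum_struveSeries (ν := μ + 1 / 2) (by linarith) ((x / 2) ^ 2)).mul_left
    (x / 2)).mul_left (√Real.pi * Real.Gamma (μ + 1) / 2) using 2 with k
  have e : ∀ u : ℝ, f k u = (-1) ^ k * x ^ (2 * k + 1) / (2 * k + 1).factorial *
      (u ^ (2 * k + 1) * (1 - u ^ 2) ^ μ) := fun u => by
    simp only [f, ContinuousMap.coe_mk]; ring
  simp only [e]
  rw [intervalIntegral.integral_const_mul, integral_pow_mul_one_sub_sq_rpow k hμ]
  have e1 : (k : ℝ) + (μ + 1 / 2) + 3 / 2 = μ + k + 2 := by ring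
  have hd := factorial_mul_Gamma_add_three_halves k
  have g1 : Real.Gamma (μ + k + 2) ≠ 0 := (Real.Gamma_pos_of_pos (by positivity)).ne'
  have g2 : Real.Gamma ((k : ℝ) + 3 / 2) ≠ 0 := (Real.Gamma_pos_of_pos (by positivity)).ne'
  have g3 : ((2 * k + 1).factorial : ℝ) ≠ 0 := by positivity
  rw [e1]
  have hd' : (k.factorial : ℝ) =
      (2 * k + 1).factorial * √Real.pi / 2 ^ (2 * k + 1) / Real.Gamma (k + 3 / 2) := by
    rw [← hd]; field_simp
  have h4 : (4 : ℝ) ^ k = 2 ^ (k * 2) := by rw [mul_comm, pow_mul]; norm_num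
  rw [hd', div_pow, div_pow]
  field_simp
  ring_nf
  rw [h4]

/-- Integration by parts in Poisson's integral. The derivative of `(1 - u²) ^ μ` may be unbounded
at `1`, but it is integrable, having constant sign. -/
theorem exists_mul_integral_eq_one_sub {μ : ℝ} (hμ : 0 < μ) :
    ∃ g : ℝ → ℝ, IntervalIntegrable g volume 0 1 ∧ ∀ x : ℝ,
      x * ∫ u in (0 : ℝ)..1, (1 - u ^ 2) ^ μ * Real.sin (x * u) =
        1 - ∫ u in (0 : ℝ)..1, g u * Real.cos (x * u) := by
  have hd : ∀ u ∈ Ioo (min (0 : ℝ) 1) (max 0 1), HasDerivAt (fun u : ℝ => (1 - u ^ 2) ^ μ)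
      (-(2 * μ * u * (1 - u ^ 2) ^ (μ - 1))) u := by
    intro u hu
    rw [min_eq_left zero_le_one, max_eq_right zero_le_one] at hu
    exact hasDerivAt_one_sub_sq_rpow (Or.inl (by nlinarith [hu.1, hu.2]))
  have hc := (continuous_one_sub_sq_rpow hμ.le).continuousOn (s := uIcc (0 : ℝ) 1)
  have hi : IntervalIntegrable (fun u : ℝ => 2 * μ * u * (1 - u ^ 2) ^ (μ - 1)) volume 0 1 := by
    refine intervalIntegral.intervalIntegrable_deriv_of_nonneg (g := fun u => -(1 - u ^ 2) ^ μ)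
      hc.neg (fun u hu => ?_) fun u hu => ?_
    · convert! (hd u hu).neg using 1
      ring
    · rw [min_eq_left zero_le_one, max_eq_right zero_le_one] at hu
      have : 0 ≤ 1 - u ^ 2 := by nlinarith [hu.1, hu.2]
      have := hu.1
      positivity
  refine ⟨_, hi, fun x => ?_⟩
  have hs : ∀ u : ℝ, HasDerivAt (fun u => -Real.cos (x * u)) (x * Real.sin (x * u)) u := fun u => by
    convert! ((hasDerivAt_id u).const_mul x).cos.neg using 1
    simp; ring
  have h := intervalIntegral.integral_mul_deriv_eq_deriv_mul_of_hasDerivAt hc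
    (by fun_prop : Continuous fun u => -Real.cos (x * u)).continuousOn hd (fun u _ => hs u)
    hi.neg
    ((by fun_prop : Continuous fun u => x * Real.sin (x * u)).intervalIntegrable _ _)
  rw [← intervalIntegral.integral_const_mul]
  simp only [neg_mul_neg] at h
  simp only [mul_left_comm x]
  rw [h]
  simp [Real.zero_rpow hμ.ne']

/-- The Riemann-Lebesgue lemma for the cosine transform over `[0, 1]`. -/
theorem tendsto_integral_mul_cos {g : ℝ → ℝ} (hg : IntervalIntegrable g volume 0 1) :
    Tendsto (fun x : ℝ => ∫ u in (0 : ℝ)..1, g u * Real.cos (x * u)) atTop (𝓝 0) := by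
  have hg' : IntegrableOn g (Ioc 0 1) := by
    rwa [intervalIntegrable_iff_integrableOn_Ioc_of_le zero_le_one] at hg
  have h := Real.tendsto_integral_exp_smul_cocompact (indicator (Ioc 0 1) fun u => (g u : ℂ))
  have h1 : Tendsto (fun x : ℝ => x / (2 * Real.pi)) atTop (cocompact ℝ) :=
    (tendsto_id.atTop_div_const (by positivity)).mono_right atTop_le_cocompact
  have h2 := (Complex.continuous_re.tendsto 0).comp (h.comp h1)
  simp only [Complex.zero_re] at h2
  refine h2.congr fun x => ?_
  simp only [Function.comp]
  have e : (fun v : ℝ => Real.fourierChar (-(v * (x / (2 * Real.pi)))) •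
      indicator (Ioc 0 1) (fun u => (g u : ℂ)) v) = indicator (Ioc 0 1) (fun v =>
        Complex.exp (((-(x * v) : ℝ) : ℂ) * Complex.I) * (g v : ℂ)) := by
    ext v
    by_cases hv : v ∈ Ioc (0 : ℝ) 1
    · simp only [indicator_of_mem hv, Circle.smul_def, Real.fourierChar_apply, smul_eq_mul]
      congr 3
      norm_cast
      field_simp
    · simp only [indicator_of_notMem hv, smul_zero]
  rw [e, integral_indicator measurableSet_Ioc, intervalIntegral.integral_of_le zero_le_one]
  have hI : Integrable (fun v => Complex.exp (((-(x * v) : ℝ) : ℂ) * Complex.I) * (g v : ℂ))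
      (volume.restrict (Ioc 0 1)) := by
    refine Integrable.bdd_mul (c := 1) hg'.ofReal
      (by fun_prop : Continuous fun v : ℝ =>
        Complex.exp (((-(x * v) : ℝ) : ℂ) * Complex.I)).aestronglyMeasurable ?_
    exact ae_of_all _ fun v => by rw [Complex.norm_exp_ofReal_mul_I]
  have hre := integral_re hI
  simp only [RCLike.re_to_complex] at hre
  rw [← hre]
  refine integral_congr_ae (ae_of_all _ fun v => ?_)
  simp [Complex.exp_re, mul_comm]

/-- Poisson's integral, integrated by parts, in terms of `W`. -/
theorem exists_struvePrimitive_eq {α : ℝ} (hα : -1 / 2 < α) :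
    ∃ c : ℝ, 0 < c ∧ ∃ g : ℝ → ℝ, IntervalIntegrable g volume 0 1 ∧ ∀ t : ℝ, 0 < t →
      struvePrimitive α t = c * t ^ (2 * α + 1) *
        (1 - ∫ u in (0 : ℝ)..1, g u * Real.cos (t * u)) := by
  have hμ : 0 < α + 1 / 2 := by linarith
  obtain ⟨g, hg, h⟩ := exists_mul_integral_eq_one_sub hμ
  have hG : 0 < Real.Gamma (α + 1 / 2 + 1) := Real.Gamma_pos_of_pos (by linarith)
  have hK : 0 < √Real.pi * Real.Gamma (α + 1 / 2 + 1) / 2 := by positivity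
  refine ⟨(2 ^ (α + 1) * (√Real.pi * Real.Gamma (α + 1 / 2 + 1) / 2))⁻¹, by positivity, g, hg,
    fun t ht => ?_⟩
  rw [← h t, integral_one_sub_sq_rpow_mul_sin hμ, struvePrimitive, struveH_eq_struveSeries]
  have e1 : α + 1 / 2 + 1 / 2 = α + 1 := by ring
  have e2 : t ^ (2 * α + 1) * t = t ^ (α + 1) * t ^ (α + 1) := by
    rw [← Real.rpow_add ht, ← Real.rpow_add_one ht.ne']; congr 1; ring
  have e3 : (t / 2) ^ (α + 1 + 1) = t ^ (α + 1) / 2 ^ (α + 1) * (t / 2) := by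
    rw [Real.rpow_add_one (by positivity), Real.div_rpow ht.le (by norm_num)]
  rw [e1, e3]
  generalize √Real.pi * Real.Gamma (α + 1 / 2 + 1) / 2 = K at hK
  generalize struveSeries (α + 1) ((t / 2) ^ 2) = S
  symm
  calc _ = (2 ^ (α + 1))⁻¹ * (K⁻¹ * K) * (t ^ (2 * α + 1) * t) * (t / 2 * S) := by
        rw [mul_inv]; ring
    _ = _ := by rw [inv_mul_cancel₀ hK.ne', e2]; ring

theorem exists_abs_struvePrimitive_le {α : ℝ} (hα : -1 / 2 < α) :
    ∃ C : ℝ, 0 < C ∧ ∀ t : ℝ, 0 < t → |struvePrimitive α t| ≤ C * t ^ (2 * α + 1) := by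
  obtain ⟨c, hc, g, hg, h⟩ := exists_struvePrimitive_eq hα
  have hI : 0 ≤ ∫ u in (0 : ℝ)..1, |g u| :=
    intervalIntegral.integral_nonneg zero_le_one fun u _ => abs_nonneg _
  refine ⟨c * (1 + ∫ u in (0 : ℝ)..1, |g u|), by positivity, fun t ht => ?_⟩
  have h1 : |∫ u in (0 : ℝ)..1, g u * Real.cos (t * u)| ≤ ∫ u in (0 : ℝ)..1, |g u| := by
    rw [← Real.norm_eq_abs]
    refine intervalIntegral.norm_integral_le_of_norm_le zero_le_one (ae_of_all _ fun u _ => ?_)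
      hg.abs
    rw [norm_mul, Real.norm_eq_abs, Real.norm_eq_abs]
    exact mul_le_of_le_one_right (abs_nonneg _) (Real.abs_cos_le_one _)
  rw [h t ht, abs_mul, abs_of_pos (by positivity : 0 < c * t ^ (2 * α + 1))]
  have h2 : |1 - ∫ u in (0 : ℝ)..1, g u * Real.cos (t * u)| ≤ 1 + ∫ u in (0 : ℝ)..1, |g u| :=
    (abs_sub _ _).trans (by rw [abs_one]; gcongr)
  calc _ ≤ c * t ^ (2 * α + 1) * (1 + ∫ u in (0 : ℝ)..1, |g u|) := by gcongr
    _ = _ := by ring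

theorem exists_tendsto_struvePrimitive_div_atTop {α : ℝ} (hα : -1 / 2 < α) :
    ∃ c : ℝ, 0 < c ∧
      Tendsto (fun t => struvePrimitive α t / t ^ (2 * α + 1)) atTop (𝓝 c) := by
  obtain ⟨c, hc, g, hg, h⟩ := exists_struvePrimitive_eq hα
  refine ⟨c, hc, ?_⟩
  have h1 : Tendsto (fun t : ℝ => c * (1 - ∫ u in (0 : ℝ)..1, g u * Real.cos (t * u))) atTop
      (𝓝 c) := by
    simpa using ((tendsto_integral_mul_cos hg).const_sub 1).const_mul c
  refine h1.congr' ?_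
  filter_upwards [eventually_gt_atTop 0] with t ht
  rw [h t ht]
  have : t ^ (2 * α + 1) ≠ 0 := by positivity
  field_simp

/-- The increment `W(2t) - W(t)` is at least of the order of `t ^ (2α + 1)` at infinity, because
`2α + 1 > 0`. -/
theorem exists_le_struvePrimitive_sub_atTop {α : ℝ} (hα : -1 / 2 < α) :
    ∃ c T : ℝ, 0 < c ∧ 0 < T ∧ ∀ t : ℝ, T ≤ t →
      c * t ^ (2 * α + 1) ≤ struvePrimitive α (2 * t) - struvePrimitive α t := by
  obtain ⟨c, hc, h⟩ := exists_tendsto_struvePrimitive_div_atTop hα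
  have h2 : Tendsto (fun t : ℝ => (struvePrimitive α (2 * t) / (2 * t) ^ (2 * α + 1)) *
      2 ^ (2 * α + 1) - struvePrimitive α t / t ^ (2 * α + 1)) atTop
      (𝓝 (c * 2 ^ (2 * α + 1) - c)) :=
    ((h.comp (tendsto_id.const_mul_atTop two_pos)).mul_const _).sub h
  have h1 : (1 : ℝ) < 2 ^ (2 * α + 1) := Real.one_lt_rpow (by norm_num) (by linarith)
  have hpos : 0 < c * 2 ^ (2 * α + 1) - c := by nlinarith
  obtain ⟨T, hT⟩ := eventually_atTop.1 (h2.eventually_const_le (half_lt_self hpos))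
  refine ⟨(c * 2 ^ (2 * α + 1) - c) / 2, max T 1, by positivity, by positivity, fun t ht => ?_⟩
  have ht0 : 0 < t := lt_of_lt_of_le one_pos ((le_max_right _ _).trans ht)
  have h3 := hT t ((le_max_left _ _).trans ht)
  rw [Real.mul_rpow (by norm_num) ht0.le] at h3
  have h4 : 0 < t ^ (2 * α + 1) := by positivity
  have h5 : (0 : ℝ) < 2 ^ (2 * α + 1) := by positivity
  calc _ ≤ _ := mul_le_mul_of_nonneg_right h3 h4.le
    _ = _ := by field_simp

/-- The increment `W(2t) - W(t)` is at least of the order of `t ^ (2α + 3)` at `0`, as read off from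
the power series. -/
theorem exists_le_struvePrimitive_sub_zero {α : ℝ} (hα : -1 / 2 < α) :
    ∃ c T : ℝ, 0 < c ∧ 0 < T ∧ ∀ t : ℝ, 0 < t → t ≤ T →
      c * t ^ (2 * α + 3) ≤ struvePrimitive α (2 * t) - struvePrimitive α t := by
  have hF := continuous_struveSeries (ν := α + 1) (by linarith)
  have hF0 := struveSeries_zero_pos (ν := α + 1) (by linarith)
  have h2 : Tendsto (fun t : ℝ => 2 ^ (2 * α + 3) * struveSeries (α + 1) (t ^ 2) -
      struveSeries (α + 1) ((t / 2) ^ 2)) (𝓝 0)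
      (𝓝 (2 ^ (2 * α + 3) * struveSeries (α + 1) 0 - struveSeries (α + 1) 0)) := by
    have : Continuous (fun t : ℝ => 2 ^ (2 * α + 3) * struveSeries (α + 1) (t ^ 2) -
      struveSeries (α + 1) ((t / 2) ^ 2)) := by fun_prop
    simpa using this.tendsto 0
  have h1 : (1 : ℝ) < 2 ^ (2 * α + 3) := Real.one_lt_rpow (by norm_num) (by linarith)
  have hpos : 0 < 2 ^ (2 * α + 3) * struveSeries (α + 1) 0 - struveSeries (α + 1) 0 := by nlinarith
  obtain ⟨T, hT, hb⟩ := Metric.eventually_nhds_iff.1 (h2.eventually_const_le (half_lt_self hpos))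
  set d := (2 ^ (2 * α + 3) * struveSeries (α + 1) 0 - struveSeries (α + 1) 0) / 2
  refine ⟨2 ^ (α + 1) * (d * (1 / 2) ^ (2 * α + 3)), T / 2, by positivity, by positivity,
    fun t ht htT => ?_⟩
  have h3 := hb (y := t) (by rw [Real.dist_eq, sub_zero, abs_of_pos ht]; linarith)
  have e : ∀ s : ℝ, 0 < s → (s ^ 2) ^ (α + 3 / 2) = s ^ (2 * α + 3) := fun s hs => by
    rw [← Real.rpow_natCast, ← Real.rpow_mul hs.le]; congr 1; push_cast; ring
  rw [struvePrimitive_eq α ht, struvePrimitive_eq α (by positivity), e _ (by positivity),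
    e _ (by positivity), mul_div_cancel_left₀ _ (two_ne_zero)]
  have e2 : t ^ (2 * α + 3) = 2 ^ (2 * α + 3) * (t / 2) ^ (2 * α + 3) := by
    rw [← Real.mul_rpow (by norm_num) (by positivity)]; congr 1; ring
  have e3 : (t / 2) ^ (2 * α + 3) = t ^ (2 * α + 3) * (1 / 2) ^ (2 * α + 3) := by
    rw [← Real.mul_rpow ht.le (by norm_num)]; congr 1; ring
  have h6 : 0 < (t / 2) ^ (2 * α + 3) := by positivity
  have h7 := mul_le_mul_of_nonneg_left h3
    (by positivity : 0 ≤ (2 : ℝ) ^ (α + 1) * (t / 2) ^ (2 * α + 3))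
  calc 2 ^ (α + 1) * (d * (1 / 2) ^ (2 * α + 3)) * t ^ (2 * α + 3)
      = 2 ^ (α + 1) * (t / 2) ^ (2 * α + 3) * d := by rw [e3]; ring
    _ ≤ _ := h7
    _ = _ := by rw [e2]; ring

/-! ### Bounds for the kernel `t ^ (1 / 2) 𝐇_α(t)` -/

/-- The kernel `K(t) = t ^ (1 / 2) 𝐇_α(t)` of the `ℋ_α` transform. -/
noncomputable def struveKernel (α t : ℝ) : ℝ := t ^ (1 / 2 : ℝ) * struveH α t

theorem continuousOn_struveKernel {α : ℝ} (hα : -1 / 2 < α) :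
    ContinuousOn (struveKernel α) (Ioi 0) :=
  (ContinuousOn.rpow_const (by fun_prop) fun _ _ => Or.inr (by norm_num)).mul
    (continuousOn_struveH hα)

theorem exists_abs_struveKernel_le {α : ℝ} (hα : -1 / 2 < α) (L : ℝ) :
    ∃ C : ℝ, 0 ≤ C ∧ ∀ t : ℝ, 0 < t → t ≤ L → |struveKernel α t| ≤ C * t ^ (α + 3 / 2) := by
  have hF := continuous_struveSeries hα
  obtain ⟨M, hM⟩ := (isCompact_Icc (a := 0) (b := L)).exists_bound_of_continuousOn
    (f := fun t : ℝ => struveSeries α ((t / 2) ^ 2)) (by fun_prop)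
  refine ⟨(1 / 2) ^ (α + 1) * |M|, by positivity, fun t ht htL => ?_⟩
  have h1 : |struveSeries α ((t / 2) ^ 2)| ≤ |M| := (hM t ⟨ht.le, htL⟩).trans (le_abs_self _)
  have e3 : (t / 2) ^ (α + 1) = t ^ (α + 1) * (1 / 2) ^ (α + 1) := by
    rw [← Real.mul_rpow ht.le (by norm_num)]; congr 1; ring
  have e4 : t ^ (α + 3 / 2) = t ^ (1 / 2 : ℝ) * t ^ (α + 1) := by
    rw [← Real.rpow_add ht]; congr 1; ring
  rw [struveKernel, struveH_eq_struveSeries, e3, e4, abs_mul, abs_mul, abs_of_pos (by positivity),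
    abs_of_pos (by positivity)]
  calc _ ≤ t ^ (1 / 2 : ℝ) * (t ^ (α + 1) * (1 / 2) ^ (α + 1) * |M|) := by gcongr
    _ = _ := by ring

/-- The kernel has integrals over `[A, B]` of the order of `B ^ (α + 1 / 2)`, although for
`α < 1 / 2` the kernel itself is not `O(t ^ (α - 1 / 2))`: integrate by parts in
`K(t) = t ^ (-(α + 1 / 2)) W'(t)`. -/
theorem exists_abs_integral_struveKernel_le {α : ℝ} (hα : -1 / 2 < α) :
    ∃ C : ℝ, 0 < C ∧ ∀ A B : ℝ, 0 < A → A ≤ B →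
      |∫ t in A..B, struveKernel α t| ≤ C * B ^ (α + 1 / 2) := by
  obtain ⟨C, hC, hW⟩ := exists_abs_struvePrimitive_le hα
  refine ⟨3 * C, by positivity, fun A B hA hAB => ?_⟩
  have hB : 0 < B := hA.trans_le hAB
  have ha : 0 < α + 1 / 2 := by linarith
  have hpos : ∀ t ∈ uIcc A B, 0 < t := fun t ht => hA.trans_le (by
    rw [uIcc_of_le hAB] at ht; exact ht.1)
  have hsub : uIcc A B ⊆ Ioi 0 := hpos
  have hu : ∀ t ∈ uIcc A B, HasDerivAt (fun t : ℝ => t ^ (-(α + 1 / 2)))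
      (-(α + 1 / 2) * t ^ (-(α + 1 / 2) - 1)) t := fun t ht =>
    Real.hasDerivAt_rpow_const (Or.inl (hpos t ht).ne')
  have hv : ∀ t ∈ uIcc A B, HasDerivAt (struvePrimitive α) (t ^ (α + 1) * struveH α t) t :=
    fun t ht => hasDerivAt_struvePrimitive hα (hpos t ht)
  have hcu : ContinuousOn (fun t : ℝ => -(α + 1 / 2) * t ^ (-(α + 1 / 2) - 1)) (uIcc A B) :=
    continuousOn_const.mul (ContinuousOn.rpow_const (by fun_prop) fun t ht =>
      Or.inl (hpos t ht).ne')
  have hcv : ContinuousOn (fun t : ℝ => t ^ (α + 1) * struveH α t) (uIcc A B) :=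
    (ContinuousOn.rpow_const (by fun_prop) fun t ht => Or.inl (hpos t ht).ne').mul
      ((continuousOn_struveH hα).mono hsub)
  have h := intervalIntegral.integral_mul_deriv_eq_deriv_mul hu hv hcu.intervalIntegrable
    hcv.intervalIntegrable
  have e : ∫ t in A..B, struveKernel α t =
      ∫ t in A..B, t ^ (-(α + 1 / 2)) * (t ^ (α + 1) * struveH α t) := by
    refine intervalIntegral.integral_congr fun t ht => ?_
    simp only [struveKernel]
    rw [← mul_assoc, ← Real.rpow_add (hpos t ht)]
    congr 2; ring
  have hb : ∀ t : ℝ, 0 < t → |t ^ (-(α + 1 / 2)) * struvePrimitive α t| ≤ C * t ^ (α + 1 / 2) := by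
    intro t ht
    rw [abs_mul, abs_of_pos (by positivity)]
    calc _ ≤ t ^ (-(α + 1 / 2)) * (C * t ^ (2 * α + 1)) := by gcongr; exact hW t ht
      _ = C * (t ^ (-(α + 1 / 2)) * t ^ (2 * α + 1)) := by ring
      _ = _ := by rw [← Real.rpow_add ht]; congr 2; ring
  have hI : |∫ t in A..B, -(α + 1 / 2) * t ^ (-(α + 1 / 2) - 1) * struvePrimitive α t| ≤
      C * B ^ (α + 1 / 2) := by
    have hi : IntervalIntegrable (fun t : ℝ => C * ((α + 1 / 2) * t ^ (α - 1 / 2))) volume A B :=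
      (continuousOn_const.mul (continuousOn_const.mul (ContinuousOn.rpow_const (by fun_prop)
        fun t ht => Or.inl (hpos t ht).ne'))).intervalIntegrable
    calc _ ≤ ∫ t in A..B, C * ((α + 1 / 2) * t ^ (α - 1 / 2)) := by
          rw [← Real.norm_eq_abs]
          refine intervalIntegral.norm_integral_le_of_norm_le hAB (ae_of_all _ fun t ht => ?_) hi
          have ht0 : 0 < t := hA.trans ht.1
          have e1 : t ^ (-(α + 1 / 2) - 1) = t ^ (-(α + 1 / 2)) * t⁻¹ := by
            rw [Real.rpow_sub_one ht0.ne', div_eq_mul_inv]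
          have e2 : t ^ (α - 1 / 2) = t ^ (α + 1 / 2) * t⁻¹ := by
            rw [← div_eq_mul_inv, ← Real.rpow_sub_one ht0.ne']; congr 1; ring
          rw [e1, e2, Real.norm_eq_abs]
          calc _ = |-((α + 1 / 2) * t⁻¹) * (t ^ (-(α + 1 / 2)) * struvePrimitive α t)| := by
                congr 1; ring
            _ = (α + 1 / 2) * t⁻¹ * |t ^ (-(α + 1 / 2)) * struvePrimitive α t| := by
                rw [abs_mul, abs_neg, abs_of_pos (by positivity : 0 < (α + 1 / 2) * t⁻¹)]
            _ ≤ (α + 1 / 2) * t⁻¹ * (C * t ^ (α + 1 / 2)) := by gcongr; exact hb t ht0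
            _ = _ := by ring
      _ = C * (B ^ (α + 1 / 2) - A ^ (α + 1 / 2)) := by
          rw [intervalIntegral.integral_const_mul, intervalIntegral.integral_const_mul,
            integral_rpow (Or.inl (by linarith))]
          have : α - 1 / 2 + 1 = α + 1 / 2 := by ring
          rw [this, mul_div_cancel₀ _ ha.ne']
      _ ≤ _ := by
          have : 0 ≤ A ^ (α + 1 / 2) := by positivity
          gcongr; linarith
  have hAB' : A ^ (α + 1 / 2) ≤ B ^ (α + 1 / 2) := by gcongr
  have hbA := (hb A hA).trans (mul_le_mul_of_nonneg_left hAB' hC.le)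
  have hbB := hb B hB
  rw [e, h]
  rw [abs_le] at *
  constructor <;> linarith [hbA.1, hbA.2, hbB.1, hbB.2, hI.1, hI.2]

/-! ### Integration against functions of bounded variation -/

theorem LocallyBoundedVariationOn.aestronglyMeasurable_restrict_Ioi {f : ℝ → ℂ} {c : ℝ}
    (hf : LocallyBoundedVariationOn f (Ioi c)) :
    AEStronglyMeasurable f (volume.restrict (Ioi c)) := by
  have hreal : ∀ g : ℝ → ℝ, LocallyBoundedVariationOn g (Ioi c) →
      AEMeasurable g (volume.restrict (Ioi c)) := by
    intro g hg
    obtain ⟨p, q, hp, hq, rfl⟩ := hg.exists_monotoneOn_sub_monotoneOn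
    exact (aemeasurable_restrict_of_monotoneOn measurableSet_Ioi hp).sub
      (aemeasurable_restrict_of_monotoneOn measurableSet_Ioi hq)
  have hre := hreal _ (LipschitzWith.comp_locallyBoundedVariationOn Complex.reCLM.lipschitz hf)
  have him := hreal _ (LipschitzWith.comp_locallyBoundedVariationOn Complex.imCLM.lipschitz hf)
  have h := (Complex.measurable_ofReal.comp_aemeasurable hre).add
    ((Complex.measurable_ofReal.comp_aemeasurable him).mul_const Complex.I)
  refine (h.congr (ae_of_all _ fun x => ?_)).aestronglyMeasurable
  simp [Complex.re_add_im]

/-- A locally bounded variation function has a variation function `v`, a monotone function whose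
increments dominate those of `f`. -/
theorem LocallyBoundedVariationOn.exists_norm_sub_le {f : ℝ → ℂ} {s : Set ℝ}
    (hf : LocallyBoundedVariationOn f s) {c : ℝ} (hc : c ∈ s) :
    ∃ v : ℝ → ℝ, ∀ x ∈ s, ∀ y ∈ s, x ≤ y →
      ‖f y - f x‖ ≤ v y - v x ∧ v y - v x = (eVariationOn f (s ∩ Icc x y)).toReal := by
  refine ⟨variationOnFromTo f s c, fun x hx y hy hxy => ?_⟩
  have h := variationOnFromTo.add hf hc hx hy
  have h1 := variationOnFromTo.eq_of_le f s hxy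
  have h2 := (hf x y hx hy).dist_le (x := y) (y := x) ⟨hy, hxy, le_rfl⟩ ⟨hx, le_rfl, hxy⟩
  rw [dist_eq_norm] at h2
  constructor <;> linarith

theorem LocallyBoundedVariationOn.integrableOn_Icc {f : ℝ → ℂ}
    (hf : LocallyBoundedVariationOn f (Ioi 0)) {a b : ℝ} (ha : 0 < a) :
    IntegrableOn f (Icc a b) := by
  rcases lt_or_ge b a with hab | hab
  · simp [Icc_eq_empty_of_lt hab]
  obtain ⟨v, hv⟩ := hf.exists_norm_sub_le (c := a) ha
  refine IntegrableOn.of_bound (C := ‖f a‖ + (v b - v a)) measure_Icc_lt_top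
    (hf.aestronglyMeasurable_restrict_Ioi.mono_set fun x hx => ha.trans_le hx.1) ?_
  refine (ae_restrict_iff' measurableSet_Icc).2 (ae_of_all _ fun x hx => ?_)
  have hx0 : x ∈ Ioi (0 : ℝ) := ha.trans_le hx.1
  have h1 := (hv a ha x hx0 hx.1).1
  have h2 := (norm_nonneg _).trans (hv x hx0 b (ha.trans_le hab) hx.2).1
  have h3 := norm_le_norm_add_norm_sub' (f x) (f a)
  linarith

/-- Abel summation. -/
theorem sum_range_sub_mul_sub (F G : ℕ → ℂ) (n : ℕ) :
    ∑ i ∈ Finset.range n, (F i - F 0) * (G i - G (i + 1)) =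
      ∑ i ∈ Finset.range n, (F (i + 1) - F i) * G (i + 1) - (F n - F 0) * G n := by
  induction n with
  | zero => simp
  | succ n ih => rw [Finset.sum_range_succ, Finset.sum_range_succ, ih]; ring

/-- A bound for `∫ (f - f(a)) g` by the variation of `f` and the size of the integrals of `g`:
the integration by parts for Stieltjes integrals, obtained from Abel summation over uniform
partitions. -/
theorem norm_integral_sub_mul_le {f g : ℝ → ℂ} {v : ℝ → ℝ} {a b M : ℝ} (hab : a ≤ b)
    (hf : IntervalIntegrable f volume a b) (hg : ContinuousOn g (Icc a b))
    (hv : ∀ x ∈ Icc a b, ∀ y ∈ Icc a b, x ≤ y → ‖f y - f x‖ ≤ v y - v x)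
    (hM : ∀ s ∈ Icc a b, ‖∫ x in s..b, g x‖ ≤ M) :
    ‖∫ x in a..b, (f x - f a) * g x‖ ≤ (v b - v a) * M := by
  obtain ⟨B, hB⟩ := isCompact_Icc.exists_bound_of_continuousOn hg
  have hB0 : 0 ≤ B := (norm_nonneg _).trans (hB a ⟨le_rfl, hab⟩)
  have hV0 : 0 ≤ v b - v a := (norm_nonneg _).trans (hv a ⟨le_rfl, hab⟩ b ⟨hab, le_rfl⟩ hab)
  -- On the partition into `n` equal parts, replacing `f` by its left endpoint values costs
  -- `O(1 / n)`, and Abel summation bounds the remaining step function by `(v b - v a) * M`.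
  have key : ∀ n : ℕ, 0 < n →
      ‖∫ x in a..b, (f x - f a) * g x‖ ≤ (v b - v a) * M + (v b - v a) * B * (b - a) * (1 / n) := by
    intro n hn
    have hn0 : (0 : ℝ) < n := by exact_mod_cast hn
    set t : ℕ → ℝ := fun i => a + i * ((b - a) / n) with ht
    have h0 : t 0 = a := by simp [ht]
    have htn : t n = b := by simp only [ht]; field_simp; ring
    have hmono : Monotone t := fun i j hij => by
      have h1 : (i : ℝ) ≤ j := by exact_mod_cast hij
      have h2 : 0 ≤ (b - a) / n := div_nonneg (by linarith) hn0.le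
      simp only [ht]; gcongr
    have hmem : ∀ i, i ≤ n → t i ∈ Icc a b := fun i hi =>
      ⟨h0 ▸ hmono (Nat.zero_le i), htn ▸ hmono hi⟩
    have hsub : ∀ i, i < n → Icc (t i) (t (i + 1)) ⊆ Icc a b := fun i hi =>
      Icc_subset_Icc (hmem i hi.le).1 (hmem (i + 1) hi).2
    have hstep : ∀ i, t (i + 1) - t i = (b - a) / n := fun i => by
      simp only [ht]; push_cast; ring
    have hsubu : ∀ i, i < n → uIcc (t i) (t (i + 1)) ⊆ uIcc a b := fun i hi => by
      rw [uIcc_of_le (hmono i.le_succ), uIcc_of_le hab]; exact hsub i hi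
    have hgi : ∀ i, i < n → IntervalIntegrable g volume (t i) (t (i + 1)) := fun i hi =>
      (hg.mono (by rw [uIcc_of_le (hmono i.le_succ)]; exact hsub i hi)).intervalIntegrable
    have hfi : ∀ (z : ℂ) i, i < n →
        IntervalIntegrable (fun x => (f x - z) * g x) volume (t i) (t (i + 1)) := fun z i hi =>
      ((hf.mono_set (hsubu i hi)).sub intervalIntegrable_const).mul_continuousOn
        (hg.mono (by rw [uIcc_of_le (hmono i.le_succ)]; exact hsub i hi))
    have hsum : ∫ x in a..b, (f x - f a) * g x =
        (∑ i ∈ Finset.range n, ∫ x in (t i)..(t (i + 1)), (f x - f (t i)) * g x) +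
        ∑ i ∈ Finset.range n, (f (t i) - f (t 0)) *
          ((∫ x in (t i)..b, g x) - ∫ x in (t (i + 1))..b, g x) := by
      have h1 := intervalIntegral.sum_integral_adjacent_intervals
        (f := fun x => (f x - f a) * g x) (a := t) (n := n) (hfi (f a))
      rw [h0, htn] at h1
      rw [← h1, ← Finset.sum_add_distrib]
      refine Finset.sum_congr rfl fun i hi => ?_
      have hi' := Finset.mem_range.1 hi
      have hgb : ∀ j, j ≤ n → IntervalIntegrable g volume (t j) b := fun j hj =>
        (hg.mono (by rw [uIcc_of_le (hmem j hj).2]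
                     exact Icc_subset_Icc_left (hmem j hj).1)).intervalIntegrable
      rw [← intervalIntegral.integral_add_adjacent_intervals (hgi i hi') (hgb (i + 1) hi'),
        add_sub_cancel_right, ← intervalIntegral.integral_const_mul,
        ← intervalIntegral.integral_add (hfi _ i hi') ((hgi i hi').const_mul _), h0]
      refine intervalIntegral.integral_congr fun x _ => ?_
      ring
    have hA := sum_range_sub_mul_sub (fun i => f (t i)) (fun i => ∫ x in (t i)..b, g x) n
    simp only [htn, intervalIntegral.integral_same, mul_zero, sub_zero] at hA
    have htel : ∑ i ∈ Finset.range n, (v (t (i + 1)) - v (t i)) = v b - v a := by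
      rw [Finset.sum_range_sub (fun i => v (t i)), htn, h0]
    rw [hsum, hA]
    refine (norm_add_le _ _).trans ?_
    rw [add_comm]
    gcongr
    · calc _ ≤ ∑ i ∈ Finset.range n, (v (t (i + 1)) - v (t i)) * M := by
            refine norm_sum_le_of_le _ fun i hi => ?_
            have hi' := Finset.mem_range.1 hi
            rw [norm_mul]
            have h1 := hv _ (hmem i hi'.le) _ (hmem (i + 1) hi') (hmono i.le_succ)
            exact mul_le_mul h1 (hM _ (hmem (i + 1) hi')) (norm_nonneg _)
              ((norm_nonneg _).trans h1)
        _ = _ := by rw [← Finset.sum_mul, htel]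
    · calc _ ≤ ∑ i ∈ Finset.range n, (v (t (i + 1)) - v (t i)) * (B * ((b - a) / n)) := by
            refine norm_sum_le_of_le _ fun i hi => ?_
            have hi' := Finset.mem_range.1 hi
            have hle := hmono i.le_succ
            have h1 := intervalIntegral.norm_integral_le_of_norm_le_const
              (a := t i) (b := t (i + 1)) (f := fun x => (f x - f (t i)) * g x)
              (C := (v (t (i + 1)) - v (t i)) * B) fun x hx => by
                rw [uIoc_of_le hle] at hx
                have hx' : x ∈ Icc a b := hsub i hi' ⟨hx.1.le, hx.2⟩
                have h2 := hv _ (hmem i hi'.le) x hx' hx.1.le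
                have h3 := (norm_nonneg _).trans (hv x hx' _ (hmem (i + 1) hi') hx.2)
                rw [norm_mul]
                exact mul_le_mul (by linarith) (hB x hx') (norm_nonneg _) (by linarith [norm_nonneg (f x - f (t i))])
            rw [hstep, abs_of_nonneg (div_nonneg (by linarith) hn0.le)] at h1
            exact h1.trans_eq (by ring)
        _ = _ := by rw [← Finset.sum_mul, htel]; ring
  have hlim : Tendsto (fun n : ℕ => (v b - v a) * M + (v b - v a) * B * (b - a) * (1 / n)) atTop
      (𝓝 ((v b - v a) * M + (v b - v a) * B * (b - a) * 0)) :=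
    (tendsto_one_div_atTop_nhds_zero_nat.const_mul _).const_add _
  rw [mul_zero, add_zero] at hlim
  exact ge_of_tendsto hlim ((eventually_gt_atTop 0).mono fun n hn => key n hn)

/-! ### Estimates for general monotone functions -/

/-- On a dyadic block `[a, 2a]` both the size and the variation of a general monotone function are
controlled by its mean over a larger block. -/
theorem GMWith.norm_integral_mul_le {C lam : ℝ} {f : ℝ → ℂ} (hf : GMWith C lam f) (hC : 0 ≤ C)
    (hlam : 0 < lam) {L : ℝ} (hL : lam ≤ L) (hL2 : 2 ≤ L) {a b M : ℝ} (ha : 0 < a) (hab : a ≤ b)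
    (hb : b ≤ 2 * a) {g : ℝ → ℂ} (hg : ContinuousOn g (Icc a b))
    (hM : ∀ s ∈ Icc a b, ‖∫ x in s..b, g x‖ ≤ M) :
    ‖∫ x in a..b, f x * g x‖ ≤
      (2 * C + 1) * (a⁻¹ * ∫ t in Icc (a / L) (L * a), ‖f t‖) * M := by
  have hL0 : 0 < L := by linarith
  have hM0 : 0 ≤ M := (norm_nonneg _).trans (hM a ⟨le_rfl, hab⟩)
  obtain ⟨v, hv⟩ := hf.1.exists_norm_sub_le (c := a) ha
  have hpos : ∀ x, a ≤ x → x ∈ Ioi (0 : ℝ) := fun x hx => ha.trans_le hx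
  have hint : IntegrableOn (fun t => ‖f t‖) (Icc (a / L) (L * a)) :=
    (hf.1.integrableOn_Icc (by positivity)).norm
  have hle1 : a / L ≤ a := div_le_self ha.le (by linarith)
  have hle2 : 2 * a ≤ L * a := by gcongr
  have hnn : ∀ s : Set ℝ, 0 ≤ ∫ t in s, ‖f t‖ := fun s => integral_nonneg fun _ => norm_nonneg _
  set I := ∫ t in Icc (a / L) (L * a), ‖f t‖ with hI
  -- the general monotonicity condition, on the enlarged block
  have hV : v (2 * a) - v a ≤ C / a * I := by
    have h1 := (hv a ha (2 * a) (hpos _ (by linarith)) (by linarith)).2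
    rw [h1]
    refine ENNReal.toReal_le_of_le_ofReal (mul_nonneg (by positivity) (hnn _)) ?_
    refine (eVariationOn.mono f inter_subset_right).trans ((hf.2 a ha).trans ?_)
    refine ENNReal.ofReal_le_ofReal (mul_le_mul_of_nonneg_left ?_ (by positivity))
    refine setIntegral_mono_set hint (ae_of_all _ fun _ => norm_nonneg _) ?_
    refine (Icc_subset_Icc ?_ (by gcongr)).eventuallyLE
    gcongr
  -- average `‖f a‖ ≤ ‖f t‖ + C / a * I` over `t ∈ [a, 2a]`
  have hfa : ‖f a‖ ≤ a⁻¹ * I + C / a * I := by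
    have h1 : ∀ t ∈ Icc a (2 * a), ‖f a‖ - C / a * I ≤ ‖f t‖ := fun t ht => by
      have h2 := (hv a ha t (hpos t ht.1) ht.1).1
      have h3 := (norm_nonneg _).trans (hv t (hpos t ht.1) (2 * a) (hpos _ (by linarith)) ht.2).1
      have h4 := norm_le_norm_add_norm_sub (f t) (f a)
      linarith
    have h5 : ∫ t in Icc a (2 * a), (‖f a‖ - C / a * I) ≤ ∫ t in Icc a (2 * a), ‖f t‖ :=
      setIntegral_mono_on (integrableOn_const (by simp))
        (hf.1.integrableOn_Icc ha).norm measurableSet_Icc h1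
    have h6 : ∫ t in Icc a (2 * a), ‖f t‖ ≤ I :=
      setIntegral_mono_set hint (ae_of_all _ fun _ => norm_nonneg _)
        (Icc_subset_Icc hle1 hle2).eventuallyLE
    rw [setIntegral_const, measureReal_def, Real.volume_Icc, ENNReal.toReal_ofReal (by linarith),
      smul_eq_mul] at h5
    have h7 : (2 * a - a) * (‖f a‖ - C / a * I) ≤ I := h5.trans h6
    have h8 : ‖f a‖ - C / a * I ≤ a⁻¹ * I := by
      rw [inv_mul_eq_div, le_div_iff₀ ha]; linarith
    linarith
  have hfi : IntervalIntegrable f volume a b :=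
    (intervalIntegrable_iff_integrableOn_Icc_of_le hab).2 (hf.1.integrableOn_Icc ha)
  have h1 := norm_integral_sub_mul_le hab hfi hg
    (fun x hx y hy hxy => (hv x (hpos x hx.1) y (hpos y hy.1) hxy).1) hM
  have hgi : IntervalIntegrable g volume a b :=
    ContinuousOn.intervalIntegrable (by rwa [uIcc_of_le hab])
  have hgu : ContinuousOn g (uIcc a b) := by rwa [uIcc_of_le hab]
  have h2 : ∫ x in a..b, f x * g x = (∫ x in a..b, (f x - f a) * g x) + f a * ∫ x in a..b, g x := by
    rw [← intervalIntegral.integral_const_mul, ← intervalIntegral.integral_add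
      ((hfi.sub intervalIntegrable_const).mul_continuousOn hgu) (hgi.const_mul _)]
    refine intervalIntegral.integral_congr fun x _ => ?_
    ring
  have h3 : v b - v a ≤ C / a * I := by
    have := (norm_nonneg _).trans (hv b (hpos b hab) (2 * a) (hpos _ (by linarith)) hb).1
    linarith
  calc ‖∫ x in a..b, f x * g x‖ ≤ (v b - v a) * M + ‖f a‖ * M := by
        rw [h2]
        refine (norm_add_le _ _).trans (add_le_add h1 ?_)
        rw [norm_mul]
        exact mul_le_mul_of_nonneg_left (hM a ⟨le_rfl, hab⟩) (norm_nonneg _)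
    _ ≤ (C / a * I) * M + (a⁻¹ * I + C / a * I) * M := by gcongr
    _ = _ := by ring

/-- Differences with a shift by `m` telescope, at the cost of a factor `m`. -/
theorem sum_range_sub_add_le {u : ℕ → ℝ} (hu : Antitone u) (h0 : ∀ k, 0 ≤ u k) (n m : ℕ) :
    ∑ k ∈ Finset.range n, (u k - u (k + m)) ≤ m * u 0 := by
  induction m with
  | zero => simp
  | succ m ih =>
    have h1 : ∑ k ∈ Finset.range n, (u (k + m) - u (k + (m + 1))) ≤ u 0 := by
      have h2 := Finset.sum_range_sub' (fun k => u (k + m)) n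
      have h3 : ∀ k, k + (m + 1) = k + 1 + m := fun k => by ring
      simp only [h3]
      rw [h2]
      linarith [h0 (n + m), hu (Nat.zero_le (0 + m))]
    have h4 : ∑ k ∈ Finset.range n, (u k - u (k + (m + 1))) =
        ∑ k ∈ Finset.range n, (u k - u (k + m)) +
          ∑ k ∈ Finset.range n, (u (k + m) - u (k + (m + 1))) := by
      rw [← Finset.sum_add_distrib]
      exact Finset.sum_congr rfl fun k _ => by ring
    rw [h4]
    push_cast
    linarith

/-! ### Convergence of the transform and its pointwise bound -/

theorem struveIntegrand_eq (α : ℝ) (f : ℝ → ℂ) (y x : ℝ) :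
    struveIntegrand α f y x = f x * (struveKernel α (x * y) : ℂ) := by
  simp only [struveIntegrand, struveKernel, Complex.ofReal_mul]
  ring

theorem LocallyBoundedVariationOn.integrableOn_rpow_mul_norm {f : ℝ → ℂ}
    (hf : LocallyBoundedVariationOn f (Ioi 0)) (s : ℝ) {a b : ℝ} (ha : 0 < a) :
    IntegrableOn (fun x : ℝ => x ^ s * ‖f x‖) (Icc a b) :=
  IntegrableOn.continuousOn_mul (ContinuousOn.rpow_const (by fun_prop)
    fun _ hx => Or.inl (ha.trans_le hx.1).ne') (hf.integrableOn_Icc ha).norm isCompact_Icc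

theorem StruveAdmissible.integrableOn_Ioc {α : ℝ} {f : ℝ → ℂ} (h : StruveAdmissible α f)
    (hf : LocallyBoundedVariationOn f (Ioi 0)) (R : ℝ) :
    IntegrableOn (fun x : ℝ => x ^ (α + 3 / 2) * ‖f x‖) (Ioc 0 R) := by
  have h1 := h.1
  rw [show 1 / 2 + (α + 1) = α + 3 / 2 by ring] at h1
  refine (h1.union (hf.integrableOn_rpow_mul_norm (α + 3 / 2) (b := R) one_pos)).mono_set ?_
  intro x hx
  rcases le_total x 1 with h | h
  · exact Or.inl ⟨hx.1, h⟩
  · exact Or.inr ⟨h, hx.2⟩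

theorem StruveAdmissible.integrableOn_Ioi {α : ℝ} {f : ℝ → ℂ} (h : StruveAdmissible α f)
    (hf : LocallyBoundedVariationOn f (Ioi 0)) {R : ℝ} (hR : 0 < R) :
    IntegrableOn (fun x : ℝ => x ^ (α - 1 / 2) * ‖f x‖) (Ioi R) := by
  have h1 := h.2
  rw [show α + 1 / 2 - 1 = α - 1 / 2 by ring] at h1
  refine (h1.union (hf.integrableOn_rpow_mul_norm (α - 1 / 2) (b := 1) hR)).mono_set ?_
  intro x hx
  rcases lt_or_ge 1 x with h | h
  · exact Or.inl h
  · exact Or.inr ⟨le_of_lt hx, h⟩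

/-- Absolute convergence on `(0, R]`, from the behaviour of the kernel at `0`. -/
theorem struveIntegrand_integrableOn {α : ℝ} (hα : -1 / 2 < α) {f : ℝ → ℂ}
    (hf : LocallyBoundedVariationOn f (Ioi 0)) (h : StruveAdmissible α f) {y : ℝ} (hy : 0 < y)
    (R : ℝ) : IntegrableOn (struveIntegrand α f y) (Ioc 0 R) := by
  obtain ⟨C, hC, hK⟩ := exists_abs_struveKernel_le hα (R * y)
  have hb := (h.integrableOn_Ioc hf R).const_mul (C * y ^ (α + 3 / 2))
  have hc : ContinuousOn (fun x => struveKernel α (x * y)) (Ioc 0 R) :=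
    (continuousOn_struveKernel hα).comp (by fun_prop) fun x hx => mul_pos hx.1 hy
  refine Integrable.mono' hb ?_ ?_
  · have hm : AEStronglyMeasurable f (volume.restrict (Ioc 0 R)) :=
      hf.aestronglyMeasurable_restrict_Ioi.mono_set fun x hx => hx.1
    exact (hm.mul ((Complex.continuous_ofReal.comp_continuousOn hc).aestronglyMeasurable
      measurableSet_Ioc)).congr (ae_of_all _ fun x => (struveIntegrand_eq α f y x).symm)
  · refine (ae_restrict_iff' measurableSet_Ioc).2 (ae_of_all _ fun x hx => ?_)
    rw [struveIntegrand_eq, norm_mul, Complex.norm_real, Real.norm_eq_abs]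
    have h1 := hK (x * y) (mul_pos hx.1 hy) (by gcongr; exact hx.2)
    rw [Real.mul_rpow hx.1.le hy.le] at h1
    calc _ ≤ ‖f x‖ * (C * (x ^ (α + 3 / 2) * y ^ (α + 3 / 2))) := by gcongr
      _ = _ := by ring

theorem Real.rpow_le_rpow_abs {u L : ℝ} (hu : 0 < u) (hL1 : L⁻¹ ≤ u) (hL2 : u ≤ L) (s : ℝ) :
    u ^ s ≤ L ^ |s| := by
  have hL : 0 < L := hu.trans_le hL2
  rcases le_total 0 s with h | h
  · rw [abs_of_nonneg h]; gcongr
  · rw [abs_of_nonpos h, ← inv_inv u, Real.inv_rpow (by positivity), ← Real.rpow_neg (by positivity)]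
    exact Real.rpow_le_rpow (by positivity) (inv_le_of_inv_le₀ hL hL1) (by linarith)

/-- The transform over a part of a dyadic block `[a, 2a]`. No relation between `a` and `1 / y` is
needed, since the bound for the integrals of the kernel holds on the whole half-line. -/
theorem exists_norm_integral_struveIntegrand_block_le {α : ℝ} (hα : -1 / 2 < α) {C lam : ℝ}
    (hC : 0 ≤ C) (hlam : 0 < lam) {L : ℝ} (hL : lam ≤ L) (hL2 : 2 ≤ L) :
    ∃ D : ℝ, 0 ≤ D ∧ ∀ f : ℝ → ℂ, GMWith C lam f → ∀ y a b : ℝ, 0 < y → 0 < a → a ≤ b →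
      b ≤ 2 * a → ‖∫ x in a..b, struveIntegrand α f y x‖ ≤
        D * y ^ (α - 1 / 2) * ∫ x in Icc (a / L) (L * a), x ^ (α - 1 / 2) * ‖f x‖ := by
  obtain ⟨K, hK0, hK⟩ := exists_abs_integral_struveKernel_le hα
  have hL0 : 0 < L := by linarith
  refine ⟨(2 * C + 1) * K * 2 ^ (α + 1 / 2) * L ^ |α - 1 / 2|, by positivity,
    fun f hf y a b hy ha hab hb => ?_⟩
  have hc : ContinuousOn (fun x => struveKernel α (x * y)) (Icc a b) :=
    (continuousOn_struveKernel hα).comp (by fun_prop) fun x hx => mul_pos (ha.trans_le hx.1) hy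
  have hg : ContinuousOn (fun x => ((struveKernel α (x * y) : ℝ) : ℂ)) (Icc a b) :=
    Complex.continuous_ofReal.comp_continuousOn hc
  have hM : ∀ s ∈ Icc a b, ‖∫ x in s..b, ((struveKernel α (x * y) : ℝ) : ℂ)‖ ≤
      K * 2 ^ (α + 1 / 2) * y ^ (α - 1 / 2) * a ^ (α + 1 / 2) := by
    intro s hs
    have hs0 : 0 < s := ha.trans_le hs.1
    rw [intervalIntegral.integral_ofReal, Complex.norm_real, Real.norm_eq_abs,
      intervalIntegral.integral_comp_mul_right _ hy.ne', smul_eq_mul, abs_mul,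
      abs_of_pos (inv_pos.2 hy)]
    have h1 := hK (s * y) (b * y) (by positivity) (by gcongr; exact hs.2)
    have h2 : (b * y) ^ (α + 1 / 2) ≤ (2 * a * y) ^ (α + 1 / 2) := by
      have : 0 < b := ha.trans_le hab
      have : 0 ≤ α + 1 / 2 := by linarith
      gcongr
    have h3 : y ^ (α - 1 / 2) = y⁻¹ * y ^ (α + 1 / 2) := by
      rw [inv_mul_eq_div, ← Real.rpow_sub_one hy.ne']; congr 1; ring
    calc _ ≤ y⁻¹ * (K * (2 * a * y) ^ (α + 1 / 2)) := by gcongr; exact h1.trans (by gcongr)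
      _ = _ := by
        rw [Real.mul_rpow (by positivity) hy.le, Real.mul_rpow (by norm_num) ha.le, h3]; ring
  have h := hf.norm_integral_mul_le hC hlam hL hL2 ha hab hb hg hM
  have hle : a ^ (α - 1 / 2) * ∫ t in Icc (a / L) (L * a), ‖f t‖ ≤
      L ^ |α - 1 / 2| * ∫ x in Icc (a / L) (L * a), x ^ (α - 1 / 2) * ‖f x‖ := by
    rw [← integral_const_mul, ← integral_const_mul]
    refine setIntegral_mono_on ((hf.1.integrableOn_Icc (by positivity)).norm.const_mul _)
      ((hf.1.integrableOn_rpow_mul_norm _ (by positivity)).const_mul _) measurableSet_Icc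
      fun x hx => ?_
    have hx0 : 0 < x := lt_of_lt_of_le (by positivity) hx.1
    have h4 : (a / x) ^ (α - 1 / 2) ≤ L ^ |α - 1 / 2| := by
      refine Real.rpow_le_rpow_abs (by positivity) ?_ ?_ _
      · rw [le_div_iff₀ hx0, inv_mul_le_iff₀ hL0]; exact hx.2
      · rw [div_le_iff₀ hx0]; exact (div_le_iff₀' hL0).1 hx.1
    rw [Real.div_rpow ha.le hx0.le, div_le_iff₀ (by positivity)] at h4
    calc _ ≤ (L ^ |α - 1 / 2| * x ^ (α - 1 / 2)) * ‖f x‖ := by gcongr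
      _ = _ := by ring
  have e : a ^ (α + 1 / 2) * a⁻¹ = a ^ (α - 1 / 2) := by
    rw [← div_eq_mul_inv, ← Real.rpow_sub_one ha.ne']; congr 1; ring
  simp only [struveIntegrand_eq]
  calc _ ≤ _ := h
    _ = (2 * C + 1) * K * 2 ^ (α + 1 / 2) * y ^ (α - 1 / 2) *
        ((a ^ (α + 1 / 2) * a⁻¹) * ∫ t in Icc (a / L) (L * a), ‖f t‖) := by ring
    _ ≤ (2 * C + 1) * K * 2 ^ (α + 1 / 2) * y ^ (α - 1 / 2) *
        (L ^ |α - 1 / 2| * ∫ x in Icc (a / L) (L * a), x ^ (α - 1 / 2) * ‖f x‖) := by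
        rw [e]; gcongr
    _ = _ := by ring

/-- The tail of the transform: sum the block estimate over dyadic blocks. The enlarged blocks
`[2 ^ k R / 2 ^ N, 2 ^ k R 2 ^ N]` overlap at most `2 N` times. -/
theorem exists_norm_integral_struveIntegrand_le {α : ℝ} (hα : -1 / 2 < α) {C lam : ℝ}
    (hC : 0 ≤ C) (hlam : 0 < lam) :
    ∃ D L : ℝ, 0 ≤ D ∧ 1 ≤ L ∧ ∀ f : ℝ → ℂ, GMWith C lam f → StruveAdmissible α f →
      ∀ y R S : ℝ, 0 < y → 0 < R → R ≤ S → ‖∫ x in R..S, struveIntegrand α f y x‖ ≤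
        D * y ^ (α - 1 / 2) * ∫ x in Ioi (R / L), x ^ (α - 1 / 2) * ‖f x‖ := by
  obtain ⟨N, hN⟩ := pow_unbounded_of_one_lt (max lam 2) (one_lt_two (α := ℝ))
  set L : ℝ := 2 ^ N with hLdef
  have hL2 : 2 ≤ L := (le_max_right _ _).trans hN.le
  have hL0 : 0 < L := by linarith
  obtain ⟨D, hD, hblock⟩ := exists_norm_integral_struveIntegrand_block_le hα hC hlam
    ((le_max_left _ _).trans hN.le) hL2
  refine ⟨D * (2 * N : ℕ), L, by positivity, by linarith, fun f hf hadm y R S hy hR hRS => ?_⟩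
  set h : ℝ → ℝ := fun x => x ^ (α - 1 / 2) * ‖f x‖ with hh
  set T : ℝ → ℝ := fun r => ∫ x in Ioi r, h x with hT
  have hint : ∀ r : ℝ, 0 < r → IntegrableOn h (Ioi r) := fun r hr => hadm.integrableOn_Ioi hf.1 hr
  have hnn : ∀ x : ℝ, 0 < x → 0 ≤ h x := fun x hx => by positivity
  have hT0 : ∀ r : ℝ, 0 < r → 0 ≤ T r := fun r hr =>
    setIntegral_nonneg measurableSet_Ioi fun x hx => hnn x (hr.trans hx)
  have hTanti : ∀ r s : ℝ, 0 < r → r ≤ s → T s ≤ T r := fun r s hr hrs =>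
    setIntegral_mono_set (hint r hr) ((ae_restrict_iff' measurableSet_Ioi).2
      (ae_of_all _ fun x hx => hnn x (hr.trans hx))) (Ioi_subset_Ioi hrs).eventuallyLE
  have hblock' : ∀ a b : ℝ, 0 < a → a ≤ b → b ≤ 2 * a →
      ‖∫ x in a..b, struveIntegrand α f y x‖ ≤
        D * y ^ (α - 1 / 2) * (T (a / L) - T (L * a)) := by
    intro a b ha hab hb
    refine (hblock f hf y a b hy ha hab hb).trans_eq ?_
    have h1 : a / L ≤ L * a := by
      rw [div_le_iff₀ hL0]; nlinarith [mul_pos ha hL0]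
    have h2 := intervalIntegral.integral_Ioi_sub_Ioi' (hint (a / L) (by positivity))
      (hint (L * a) (by positivity))
    simp only [hT]
    rw [h2, integral_Icc_eq_integral_Ioc, intervalIntegral.integral_of_le h1]
  have hloc : ∀ a b : ℝ, 0 < a → a ≤ b →
      IntervalIntegrable (struveIntegrand α f y) volume a b := fun a b ha hab =>
    (intervalIntegrable_iff_integrableOn_Ioc_of_le hab).2
      ((struveIntegrand_integrableOn hα hf.1 hadm hy b).mono_set (Ioc_subset_Ioc_left ha.le))
  have hiter : ∀ n : ℕ, ∀ R S : ℝ, 0 < R → R ≤ S → S ≤ 2 ^ n * R →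
      ‖∫ x in R..S, struveIntegrand α f y x‖ ≤ D * y ^ (α - 1 / 2) *
        ∑ k ∈ Finset.range n, (T (2 ^ k * R / L) - T (L * (2 ^ k * R))) := by
    intro n
    induction n with
    | zero =>
      intro R S hR hRS hS
      have : S = R := le_antisymm (by simpa using hS) hRS
      simp [this]
    | succ n ih =>
      intro R S hR hRS hS
      rw [Finset.sum_range_succ', mul_add, add_comm]
      have hk : ∀ k : ℕ, (2 : ℝ) ^ (k + 1) * R = 2 ^ k * (2 * R) := fun k => by ring
      simp only [hk, pow_zero, one_mul]
      rcases le_total S (2 * R) with hS2 | hS2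
      · have h1 := hblock' R S hR hRS hS2
        have h2 := (norm_nonneg _).trans (ih (2 * R) (2 * R) (by positivity) le_rfl
          (le_mul_of_one_le_left (by positivity) (one_le_pow₀ one_le_two)))
        linarith
      · rw [← intervalIntegral.integral_add_adjacent_intervals (hloc R (2 * R) hR (by linarith))
          (hloc (2 * R) S (by positivity) hS2)]
        exact (norm_add_le _ _).trans (add_le_add (hblock' R _ hR (by linarith) le_rfl)
          (ih (2 * R) S (by positivity) hS2 (by rw [← hk]; exact hS)))
  obtain ⟨n, hn⟩ := pow_unbounded_of_one_lt (S / R) (one_lt_two (α := ℝ))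
  have hu := sum_range_sub_add_le (u := fun k : ℕ => T (2 ^ k * R / L))
    (fun i j hij => hTanti _ _ (by positivity) (by gcongr; norm_num))
    (fun k => hT0 _ (by positivity)) n (2 * N)
  have hshift : ∀ k : ℕ, (2 : ℝ) ^ (k + 2 * N) * R / L = L * (2 ^ k * R) := fun k => by
    rw [div_eq_iff hL0.ne', pow_add, pow_mul', hLdef]; ring
  simp only [hshift, pow_zero, one_mul] at hu
  calc _ ≤ _ := hiter n R S hR hRS ((div_le_iff₀ hR).1 hn.le)
    _ ≤ D * y ^ (α - 1 / 2) * ((2 * N : ℕ) * T (R / L)) := by gcongr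
    _ = _ := by ring

theorem tendsto_setIntegral_Ioi_atTop_zero {h : ℝ → ℝ} {c : ℝ} (hi : IntegrableOn h (Ioi c)) :
    Tendsto (fun r => ∫ x in Ioi r, h x) atTop (𝓝 0) := by
  have h1 := (intervalIntegral_tendsto_integral_Ioi c hi tendsto_id).const_sub (∫ x in Ioi c, h x)
  rw [sub_self] at h1
  refine h1.congr' ?_
  filter_upwards [eventually_ge_atTop c] with r hr
  rw [id, ← intervalIntegral.integral_Ioi_sub_Ioi' hi (hi.mono_set (Ioi_subset_Ioi hr))]
  ring

theorem integral_Ioc_sub_eq {F : ℝ → ℂ} (hF : ∀ R, IntegrableOn F (Ioc 0 R)) {R S : ℝ}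
    (hR : 0 ≤ R) (hRS : R ≤ S) :
    (∫ x in Ioc 0 S, F x) - ∫ x in Ioc 0 R, F x = ∫ x in R..S, F x := by
  rw [← intervalIntegral.integral_of_le hR, ← intervalIntegral.integral_of_le (hR.trans hRS)]
  exact intervalIntegral.integral_interval_sub_left
    ((intervalIntegrable_iff_integrableOn_Ioc_of_le (hR.trans hRS)).2 (hF S))
    ((intervalIntegrable_iff_integrableOn_Ioc_of_le hR).2 (hF R))

theorem GMWith.struveConverges {α : ℝ} (hα : -1 / 2 < α) {C lam : ℝ} (hC : 0 ≤ C)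
    (hlam : 0 < lam) {f : ℝ → ℂ} (hf : GMWith C lam f) (hadm : StruveAdmissible α f) {y : ℝ}
    (hy : 0 < y) : StruveConverges α f y := by
  have hint := struveIntegrand_integrableOn hα hf.1 hadm hy
  refine ⟨fun R _ => hint R, ?_⟩
  obtain ⟨D, L, hD, hL, h⟩ := exists_norm_integral_struveIntegrand_le hα hC hlam
  refine cauchySeq_tendsto_of_complete (Metric.cauchySeq_iff'.2 fun ε hε => ?_)
  have ht : Tendsto (fun R : ℝ => D * y ^ (α - 1 / 2) *
      ∫ x in Ioi (R / L), x ^ (α - 1 / 2) * ‖f x‖) atTop (𝓝 0) := by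
    have := (tendsto_setIntegral_Ioi_atTop_zero (hadm.integrableOn_Ioi hf.1 one_pos)).comp
      (tendsto_id.atTop_div_const (by linarith : 0 < L))
    simpa using this.const_mul (D * y ^ (α - 1 / 2))
  obtain ⟨R, hRε, hR⟩ := ((ht.eventually_lt_const hε).and (eventually_gt_atTop 0)).exists
  refine ⟨R, fun S hS => ?_⟩
  rw [dist_eq_norm, integral_Ioc_sub_eq hint hR.le hS]
  exact (h f hf hadm y R S hy hR hS).trans_lt hRε

/-- The majorant `k(t) = min (t ^ (α + 3 / 2)) (t ^ (α - 1 / 2))` for the action of the Struve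
kernel on general monotone functions. -/
noncomputable def struveMajorant (α t : ℝ) : ℝ := min (t ^ (α + 3 / 2)) (t ^ (α - 1 / 2))

theorem struveMajorant_of_le_one (α : ℝ) {t : ℝ} (ht : 0 < t) (h : t ≤ 1) :
    struveMajorant α t = t ^ (α + 3 / 2) :=
  min_eq_left (Real.rpow_le_rpow_of_exponent_ge ht h (by linarith))

theorem struveMajorant_of_one_le (α : ℝ) {t : ℝ} (h : 1 ≤ t) :
    struveMajorant α t = t ^ (α - 1 / 2) :=
  min_eq_right (Real.rpow_le_rpow_of_exponent_le h (by linarith))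

theorem rpow_le_mul_struveMajorant (α : ℝ) {t L : ℝ} (ht : 0 < t) (hL : 1 ≤ L) (htL : t ≤ L) :
    t ^ (α + 3 / 2) ≤ L ^ 2 * struveMajorant α t := by
  rcases le_total t 1 with h | h
  · rw [struveMajorant_of_le_one α ht h]
    exact le_mul_of_one_le_left (by positivity) (one_le_pow₀ hL)
  · rw [struveMajorant_of_one_le α h, show α + 3 / 2 = 2 + (α - 1 / 2) by ring, Real.rpow_add ht]
    norm_cast
    gcongr

theorem struveMajorant_nonneg (α : ℝ) {t : ℝ} (ht : 0 ≤ t) : 0 ≤ struveMajorant α t :=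
  le_min (by positivity) (by positivity)

theorem StruveAdmissible.integrableOn_majorant {α : ℝ} {f : ℝ → ℂ} (h : StruveAdmissible α f)
    (hf : LocallyBoundedVariationOn f (Ioi 0)) {y : ℝ} (hy : 0 < y) :
    IntegrableOn (fun x : ℝ => struveMajorant α (x * y) * ‖f x‖) (Ioi 0) := by
  have hu : Ioi (0 : ℝ) = Ioc 0 y⁻¹ ∪ Ioi y⁻¹ := (Ioc_union_Ioi_eq_Ioi (by positivity)).symm
  rw [hu]
  refine IntegrableOn.union ?_ ?_
  · refine IntegrableOn.congr_fun ((h.integrableOn_Ioc hf y⁻¹).const_mul (y ^ (α + 3 / 2)))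
      (fun x hx => ?_) measurableSet_Ioc
    have h1 : x * y ≤ 1 := by
      have := mul_le_mul_of_nonneg_right hx.2 hy.le
      rwa [inv_mul_cancel₀ hy.ne'] at this
    rw [struveMajorant_of_le_one α (mul_pos hx.1 hy) h1, Real.mul_rpow hx.1.le hy.le]
    ring
  · refine IntegrableOn.congr_fun
      ((h.integrableOn_Ioi hf (inv_pos.2 hy)).const_mul (y ^ (α - 1 / 2)))
      (fun x hx => ?_) measurableSet_Ioi
    have hx' : y⁻¹ < x := hx
    have hx0 : 0 < x := (inv_pos.2 hy).trans hx
    have h1 : 1 ≤ x * y := by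
      have := mul_le_mul_of_nonneg_right hx'.le hy.le
      rwa [inv_mul_cancel₀ hy.ne'] at this
    rw [struveMajorant_of_one_le α h1, Real.mul_rpow hx0.le hy.le]
    ring

/-- The pointwise bound. The oscillation of the kernel has been used up: what remains is a positive
integral operator. -/
theorem exists_norm_struveTransform_le {α : ℝ} (hα : -1 / 2 < α) {C lam : ℝ} (hC : 0 ≤ C)
    (hlam : 0 < lam) :
    ∃ D : ℝ, 0 ≤ D ∧ ∀ f : ℝ → ℂ, GMWith C lam f → StruveAdmissible α f → ∀ y : ℝ, 0 < y →
      ‖struveTransform α f y‖ ≤ D * ∫ x in Ioi 0, struveMajorant α (x * y) * ‖f x‖ := by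
  obtain ⟨D, L, hD, hL, h⟩ := exists_norm_integral_struveIntegrand_le hα hC hlam
  obtain ⟨K, hK0, hK⟩ := exists_abs_struveKernel_le hα L
  have hL0 : 0 < L := by linarith
  refine ⟨K * L ^ 2 + D, by positivity, fun f hf hadm y hy => ?_⟩
  have hint := struveIntegrand_integrableOn hα hf.1 hadm hy
  obtain ⟨l, hl⟩ := (hf.struveConverges hα hC hlam hadm hy).2
  have hlim : struveTransform α f y = l := hl.limUnder_eq
  rw [hlim]
  have hmaj := hadm.integrableOn_majorant hf.1 hy
  set I := ∫ x in Ioi 0, struveMajorant α (x * y) * ‖f x‖ with hI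
  have hnn : ∀ x ∈ Ioi (0 : ℝ), 0 ≤ struveMajorant α (x * y) * ‖f x‖ := fun x hx =>
    mul_nonneg (struveMajorant_nonneg α (mul_nonneg (le_of_lt hx) hy.le)) (norm_nonneg _)
  have hnn' := (ae_restrict_iff' (μ := volume) measurableSet_Ioi).2 (ae_of_all _ hnn)
  -- Split at `L / y`, so that the tail estimate, which loses a factor `L`, starts at `1 / y`.
  have hR : 0 < L / y := by positivity
  have h1 : ‖∫ x in Ioc 0 (L / y), struveIntegrand α f y x‖ ≤ K * L ^ 2 * I := by
    have hsub : Ioc 0 (L / y) ⊆ Ioi 0 := fun x hx => hx.1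
    calc _ ≤ ∫ x in Ioc 0 (L / y), K * L ^ 2 * (struveMajorant α (x * y) * ‖f x‖) := by
          refine norm_integral_le_of_norm_le ((hmaj.mono_set hsub).const_mul _)
            ((ae_restrict_iff' measurableSet_Ioc).2 (ae_of_all _ fun x hx => ?_))
          have hxy : 0 < x * y := mul_pos hx.1 hy
          have hxL : x * y ≤ L := (le_div_iff₀ hy).1 hx.2
          rw [struveIntegrand_eq, norm_mul, Complex.norm_real, Real.norm_eq_abs]
          calc _ ≤ ‖f x‖ * (K * (L ^ 2 * struveMajorant α (x * y))) := by
                gcongr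
                exact (hK _ hxy hxL).trans
                  (mul_le_mul_of_nonneg_left (rpow_le_mul_struveMajorant α hxy hL hxL) hK0)
            _ = _ := by ring
      _ = K * L ^ 2 * ∫ x in Ioc 0 (L / y), struveMajorant α (x * y) * ‖f x‖ :=
          integral_const_mul _ _
      _ ≤ _ := by
          gcongr
          exact setIntegral_mono_set hmaj hnn' hsub.eventuallyLE
  have h2 : y ^ (α - 1 / 2) * ∫ x in Ioi (L / y / L), x ^ (α - 1 / 2) * ‖f x‖ ≤ I := by
    have e : L / y / L = y⁻¹ := by field_simp
    rw [e, ← integral_const_mul]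
    have hsub : Ioi y⁻¹ ⊆ Ioi (0 : ℝ) := Ioi_subset_Ioi (by positivity)
    refine le_trans (le_of_eq ?_) (setIntegral_mono_set hmaj hnn' hsub.eventuallyLE)
    refine setIntegral_congr_fun measurableSet_Ioi fun x hx => ?_
    have hx' : y⁻¹ < x := hx
    have hx0 : 0 < x := (inv_pos.2 hy).trans hx'
    have h1 : 1 ≤ x * y := by
      have := mul_le_mul_of_nonneg_right hx'.le hy.le
      rwa [inv_mul_cancel₀ hy.ne'] at this
    rw [struveMajorant_of_one_le α h1, Real.mul_rpow hx0.le hy.le]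
    ring
  refine le_of_tendsto hl.norm ?_
  filter_upwards [eventually_ge_atTop (L / y)] with S hS
  have h3 := integral_Ioc_sub_eq hint hR.le hS
  rw [sub_eq_iff_eq_add'] at h3
  rw [h3]
  calc _ ≤ K * L ^ 2 * I + D * y ^ (α - 1 / 2) *
        ∫ x in Ioi (L / y / L), x ^ (α - 1 / 2) * ‖f x‖ :=
        (norm_add_le _ _).trans (add_le_add h1 (h f hf hadm y _ S hy hR hS))
    _ ≤ K * L ^ 2 * I + D * I := by rw [mul_assoc D]; gcongr
    _ = _ := by ring

/-! ### A Schur test from `L^p` to `L^q` -/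

/-- A Schur test for `p ≤ q`: a positive kernel bounded by `1` whose integrals in each variable are
bounded by `M` maps `L^p` to `L^q`. By Hölder's inequality `(T g) ^ p ≤ M ^ (p - 1) U` with
`U = ∫ K g ^ p`, where `U` is bounded by `‖g‖_p ^ p` pointwise and by `M ‖g‖_p ^ p` in mean. -/
theorem lintegral_schur_rpow_le {X : Type*} [MeasurableSpace X] {μ : Measure X} [SFinite μ]
    {K : X → X → ℝ≥0∞} (hK : Measurable (Function.uncurry K)) {M : ℝ≥0∞}
    (hK1 : ∀ᵐ y ∂μ, ∀ᵐ x ∂μ, K x y ≤ 1) (hKx : ∀ᵐ y ∂μ, ∫⁻ x, K x y ∂μ ≤ M)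
    (hKy : ∀ᵐ x ∂μ, ∫⁻ y, K x y ∂μ ≤ M) {p q : ℝ} (hp : 1 < p) (hpq : p ≤ q)
    {g : X → ℝ≥0∞} (hg : AEMeasurable g μ) :
    ∫⁻ y, (∫⁻ x, K x y * g x ∂μ) ^ q ∂μ ≤
      (M ^ (p - 1)) ^ (q / p) * M * (∫⁻ x, g x ^ p ∂μ) ^ (q / p) := by
  have hp0 : 0 < p := by linarith
  have hq1 : 0 ≤ q / p - 1 := by rw [sub_nonneg, one_le_div hp0]; exact hpq
  have hqp : 0 ≤ q / p := by linarith
  have hpp := Real.HolderConjugate.conjExponent hp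
  set p' := Real.conjExponent p with hp'
  have hp'0 : 0 < p' := hpp.symm.pos
  set G := ∫⁻ x, g x ^ p ∂μ with hG
  set U : X → ℝ≥0∞ := fun y => ∫⁻ x, K x y * g x ^ p ∂μ with hU
  have hKm : ∀ y, Measurable fun x => K x y := fun y => hK.comp (measurable_id.prodMk measurable_const)
  have hUG : ∀ᵐ y ∂μ, U y ≤ G := by
    filter_upwards [hK1] with y hy
    refine lintegral_mono_ae ?_
    filter_upwards [hy] with x hx
    exact mul_le_of_le_one_left zero_le hx
  have hUM : ∫⁻ y, U y ∂μ ≤ M * G := by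
    have hm : AEMeasurable (Function.uncurry fun y x => K x y * g x ^ p) (μ.prod μ) :=
      (hK.comp measurable_swap).aemeasurable.mul
        ((hg.pow_const p).comp_quasiMeasurePreserving Measure.quasiMeasurePreserving_snd)
    rw [hU, lintegral_lintegral_swap hm, hG, ← lintegral_const_mul'' _ (hg.pow_const p)]
    refine lintegral_mono_ae ?_
    filter_upwards [hKy] with x hx
    have hKx' : Measurable fun y => K x y := hK.comp (measurable_const.prodMk measurable_id)
    rw [lintegral_mul_const _ hKx']
    gcongr
  have hT : ∀ᵐ y ∂μ, (∫⁻ x, K x y * g x ∂μ) ^ p ≤ M ^ (p - 1) * U y := by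
    filter_upwards [hKx] with y hy
    have h1 := ENNReal.lintegral_mul_le_Lp_mul_Lq μ hpp.symm
      (f := fun x => K x y ^ (1 / p')) (g := fun x => K x y ^ (1 / p) * g x)
      ((hKm y).pow_const _).aemeasurable (((hKm y).pow_const _).aemeasurable.mul hg)
    have e1 : ∀ x, K x y ^ (1 / p') * (K x y ^ (1 / p) * g x) = K x y * g x := fun x => by
      rw [← mul_assoc, ← ENNReal.rpow_add_of_nonneg _ _ (by positivity) (by positivity), add_comm]
      have := hpp.inv_add_inv_eq_one
      rw [one_div, one_div, this, ENNReal.rpow_one]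
    have e2 : ∀ x, (K x y ^ (1 / p')) ^ p' = K x y := fun x => by
      rw [← ENNReal.rpow_mul, one_div_mul_cancel hp'0.ne', ENNReal.rpow_one]
    have e3 : ∀ x, (K x y ^ (1 / p) * g x) ^ p = K x y * g x ^ p := fun x => by
      rw [ENNReal.mul_rpow_of_nonneg _ _ hp0.le, ← ENNReal.rpow_mul, one_div_mul_cancel hp0.ne',
        ENNReal.rpow_one]
    simp only [Pi.mul_apply, e1, e2, e3] at h1
    calc _ ≤ ((∫⁻ x, K x y ∂μ) ^ (1 / p') * U y ^ (1 / p)) ^ p := by gcongr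
      _ ≤ (M ^ (1 / p') * U y ^ (1 / p)) ^ p := by gcongr
      _ = _ := by
        rw [ENNReal.mul_rpow_of_nonneg _ _ hp0.le, ← ENNReal.rpow_mul, ← ENNReal.rpow_mul,
          one_div_mul_cancel hp0.ne', ENNReal.rpow_one]
        congr 2
        have := hpp.div_conj_eq_sub_one
        rw [← this]; ring
  have hfin : ∀ᵐ y ∂μ, (∫⁻ x, K x y * g x ∂μ) ^ q ≤
      (M ^ (p - 1)) ^ (q / p) * G ^ (q / p - 1) * U y := by
    filter_upwards [hT, hUG] with y h1 h2
    calc (∫⁻ x, K x y * g x ∂μ) ^ q = ((∫⁻ x, K x y * g x ∂μ) ^ p) ^ (q / p) := by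
          rw [← ENNReal.rpow_mul, mul_div_cancel₀ _ hp0.ne']
      _ ≤ (M ^ (p - 1) * U y) ^ (q / p) := by gcongr
      _ = (M ^ (p - 1)) ^ (q / p) * (U y ^ (q / p - 1) * U y) := by
          rw [ENNReal.mul_rpow_of_nonneg _ _ hqp]
          congr 1
          conv_rhs => rw [← ENNReal.rpow_one (U y), ← ENNReal.rpow_mul, one_mul,
            ← ENNReal.rpow_add_of_nonneg _ _ hq1 zero_le_one, sub_add_cancel]
      _ ≤ _ := by rw [← mul_assoc]; gcongr
  have hUae : AEMeasurable U μ := by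
    have hm : AEMeasurable (Function.uncurry fun y x => K x y * g x ^ p) (μ.prod μ) :=
      (hK.comp measurable_swap).aemeasurable.mul
        ((hg.pow_const p).comp_quasiMeasurePreserving Measure.quasiMeasurePreserving_snd)
    exact hm.lintegral_prod_right'
  calc _ ≤ ∫⁻ y, (M ^ (p - 1)) ^ (q / p) * G ^ (q / p - 1) * U y ∂μ := lintegral_mono_ae hfin
    _ = (M ^ (p - 1)) ^ (q / p) * G ^ (q / p - 1) * ∫⁻ y, U y ∂μ := lintegral_const_mul'' _ hUae
    _ ≤ (M ^ (p - 1)) ^ (q / p) * G ^ (q / p - 1) * (M * G) := by gcongr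
    _ = (M ^ (p - 1)) ^ (q / p) * M * (G ^ (q / p - 1) * G ^ (1 : ℝ)) := by
        rw [ENNReal.rpow_one]; ring
    _ = _ := by rw [← ENNReal.rpow_add_of_nonneg _ _ hq1 zero_le_one, sub_add_cancel]

/-- The weighted majorant `t ^ s k(t) = min (t ^ (s + α + 3 / 2)) (t ^ (s + α - 1 / 2))` is
integrable for `dt / t`, if the exponent at `0` is positive and that at infinity is negative. -/
theorem exists_lintegral_rpow_mul_struveMajorant_le {α s : ℝ} (h0 : 0 < s + α + 3 / 2)
    (h1 : s + α - 1 / 2 < 0) :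
    ∃ M : ℝ≥0, ∀ y : ℝ, 0 < y → ∫⁻ x in Ioi (0 : ℝ),
      ENNReal.ofReal ((x * y) ^ s * struveMajorant α (x * y)) * ENNReal.ofReal x⁻¹ ≤ M := by
  refine ⟨((s + α + 3 / 2)⁻¹ + (-(s + α - 1 / 2))⁻¹).toNNReal, fun y hy => ?_⟩
  have hu : Ioi (0 : ℝ) = Ioc 0 y⁻¹ ∪ Ioi y⁻¹ := (Ioc_union_Ioi_eq_Ioi (by positivity)).symm
  have hy' : 0 < y⁻¹ := by positivity
  have hsplit : ∀ x r : ℝ, 0 < x → (x * y) ^ s * (x * y) ^ r * x⁻¹ =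
      y ^ (s + r) * x ^ (s + r - 1) := fun x r hx => by
    rw [← Real.rpow_add (by positivity), Real.mul_rpow hx.le hy.le, Real.rpow_sub_one hx.ne']
    ring
  have hA : ∫⁻ x in Ioc 0 y⁻¹,
      ENNReal.ofReal ((x * y) ^ s * struveMajorant α (x * y)) * ENNReal.ofReal x⁻¹ =
      ENNReal.ofReal (s + α + 3 / 2)⁻¹ := by
    have e : ∀ x ∈ Ioc 0 y⁻¹, ENNReal.ofReal ((x * y) ^ s * struveMajorant α (x * y)) *
        ENNReal.ofReal x⁻¹ = ENNReal.ofReal (y ^ (s + (α + 3 / 2)) * x ^ (s + (α + 3 / 2) - 1)) := by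
      intro x hx
      have hx1 : x * y ≤ 1 := by
        have := mul_le_mul_of_nonneg_right hx.2 hy.le
        rwa [inv_mul_cancel₀ hy.ne'] at this
      rw [← ENNReal.ofReal_mul' (inv_nonneg.2 hx.1.le),
        struveMajorant_of_le_one α (mul_pos hx.1 hy) hx1, hsplit x _ hx.1]
    have hi : IntervalIntegrable (fun x : ℝ => x ^ (s + (α + 3 / 2) - 1)) volume 0 y⁻¹ :=
      intervalIntegral.intervalIntegrable_rpow' (by linarith)
    rw [setLIntegral_congr_fun measurableSet_Ioc e, ← ofReal_integral_eq_lintegral_ofReal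
      (((intervalIntegrable_iff_integrableOn_Ioc_of_le hy'.le).1 hi).const_mul _)
      ((ae_restrict_iff' measurableSet_Ioc).2 (ae_of_all _ fun x hx => by
        have := hx.1
        positivity))]
    rw [← intervalIntegral.integral_of_le hy'.le, intervalIntegral.integral_const_mul,
      integral_rpow (Or.inl (by linarith)), sub_add_cancel, Real.zero_rpow (by linarith),
      Real.inv_rpow hy.le]
    congr 1
    have : y ^ (s + (α + 3 / 2)) ≠ 0 := by positivity
    rw [sub_zero, ← mul_div_assoc, mul_inv_cancel₀ this, one_div]
    congr 1; ring
  have hB : ∫⁻ x in Ioi y⁻¹,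
      ENNReal.ofReal ((x * y) ^ s * struveMajorant α (x * y)) * ENNReal.ofReal x⁻¹ =
      ENNReal.ofReal (-(s + α - 1 / 2))⁻¹ := by
    have e : ∀ x ∈ Ioi y⁻¹, ENNReal.ofReal ((x * y) ^ s * struveMajorant α (x * y)) *
        ENNReal.ofReal x⁻¹ = ENNReal.ofReal (y ^ (s + (α - 1 / 2)) * x ^ (s + (α - 1 / 2) - 1)) := by
      intro x hx
      have hx' : y⁻¹ < x := hx
      have hx0 : 0 < x := hy'.trans hx'
      have hx1 : 1 ≤ x * y := by
        have := mul_le_mul_of_nonneg_right hx'.le hy.le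
        rwa [inv_mul_cancel₀ hy.ne'] at this
      rw [← ENNReal.ofReal_mul' (inv_nonneg.2 hx0.le), struveMajorant_of_one_le α hx1,
        hsplit x _ hx0]
    rw [setLIntegral_congr_fun measurableSet_Ioi e, ← ofReal_integral_eq_lintegral_ofReal
      ((integrableOn_Ioi_rpow_of_lt (by linarith) hy').const_mul _)
      ((ae_restrict_iff' measurableSet_Ioi).2 (ae_of_all _ fun x hx => by
        have : 0 < x := hy'.trans hx
        positivity))]
    rw [integral_const_mul, integral_Ioi_rpow_of_lt (by linarith) hy', sub_add_cancel,
      Real.inv_rpow hy.le]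
    congr 1
    have : y ^ (s + (α - 1 / 2)) ≠ 0 := by positivity
    rw [← mul_div_assoc, mul_neg, mul_inv_cancel₀ this, neg_div, one_div, ← inv_neg]
    congr 1; ring
  rw [hu, lintegral_union measurableSet_Ioi
    (Ioc_disjoint_Ioi le_rfl), hA, hB, ← ENNReal.ofReal_add (by positivity)
    (inv_nonneg.2 (by linarith))]
  rfl

theorem rpow_mul_struveMajorant_le_one {α s t : ℝ} (h0 : 0 < s + α + 3 / 2)
    (h1 : s + α - 1 / 2 < 0) (ht : 0 < t) : t ^ s * struveMajorant α t ≤ 1 := by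
  rcases le_total t 1 with h | h
  · rw [struveMajorant_of_le_one α ht h, ← Real.rpow_add ht]
    exact Real.rpow_le_one ht.le h (by linarith)
  · rw [struveMajorant_of_one_le α h, ← Real.rpow_add ht]
    exact Real.rpow_le_one_of_one_le_of_nonpos h (by linarith)

theorem powerNorm_eq {p s : ℝ} (hp : 0 < p) (g : ℝ → ℂ) :
    powerNorm p s g =
      (∫⁻ x in Ioi 0, (ENNReal.ofReal (x ^ s) * ‖g x‖ₑ) ^ p) ^ (1 / p) := by
  rw [powerNorm, eLpNorm_eq_lintegral_rpow_enorm_toReal (by simpa using hp) ENNReal.ofReal_ne_top,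
    ENNReal.toReal_ofReal hp.le]
  congr 1
  refine setLIntegral_congr_fun measurableSet_Ioi fun x hx => ?_
  have hx0 : (0 : ℝ) ≤ x := le_of_lt hx
  simp only [enorm_mul]
  rw [← ofReal_norm, Complex.norm_real, Real.norm_of_nonneg (by positivity)]

/-- The sufficiency of the conditions on `β` and `γ`. -/
theorem exists_powerNorm_struveTransform_le {α p q β γ : ℝ} (hα : -1 / 2 < α) (hp : 1 < p)
    (hpq : p ≤ q) (hβ : β = γ + 1 / q - 1 / Real.conjExponent p) (h1 : 1 / q + α - 1 / 2 < β)
    (h2 : β < 1 / q + α + 3 / 2) {C lam : ℝ} (hC : 0 ≤ C) (hlam : 0 < lam) :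
    ∃ A : ℝ≥0, ∀ f : ℝ → ℂ, GMWith C lam f → StruveAdmissible α f →
      powerNorm q (-β) (struveTransform α f) ≤ (A : ℝ≥0∞) * powerNorm p γ f := by
  have hp0 : 0 < p := by linarith
  have hq0 : 0 < q := by linarith
  obtain ⟨D, hD, hDf⟩ := exists_norm_struveTransform_le hα hC hlam
  set s : ℝ := -β + 1 / q with hs
  have hs0 : 0 < s + α + 3 / 2 := by linarith
  have hs1 : s + α - 1 / 2 < 0 := by linarith
  obtain ⟨M, hM⟩ := exists_lintegral_rpow_mul_struveMajorant_le hs0 hs1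
  have hpp := Real.HolderConjugate.conjExponent hp
  have hγ : β - 1 / q = γ + 1 / p - 1 := by
    have := hpp.inv_add_inv_eq_one
    rw [← one_div, ← one_div] at this
    linarith
  -- In terms of `μ = dx / x` and `g(x) = x ^ (γ + 1 / p) |f(x)|` the operator is a multiplicative
  -- convolution with `t ^ s k(t)`, and the norm of `x ^ γ f` is that of `g` in `L^p(μ)`.
  set d : ℝ → ℝ≥0∞ := fun x => ENNReal.ofReal x⁻¹ with hd
  have hdm : Measurable d := by fun_prop
  set μ : Measure ℝ := (volume.restrict (Ioi 0)).withDensity d with hμ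
  have hlint : ∀ F : ℝ → ℝ≥0∞, ∫⁻ x, F x ∂μ = ∫⁻ x in Ioi 0, d x * F x := fun F => by
    rw [hμ, lintegral_withDensity_eq_lintegral_mul_non_measurable _ hdm
      (ae_of_all _ fun x => ENNReal.ofReal_lt_top)]
    rfl
  have hμae : ∀ P : ℝ → Prop, (∀ x, 0 < x → P x) → ∀ᵐ x ∂μ, P x := fun P hP =>
    (withDensity_absolutelyContinuous _ _).ae_le
      ((ae_restrict_iff' measurableSet_Ioi).2 (ae_of_all _ hP))
  set K : ℝ → ℝ → ℝ≥0∞ := fun x y => ENNReal.ofReal ((x * y) ^ s * struveMajorant α (x * y)) with hK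
  have hKm : Measurable (Function.uncurry K) := by
    have : Measurable fun z : ℝ × ℝ => z.1 * z.2 := measurable_fst.mul measurable_snd
    exact ((this.pow_const s).mul ((this.pow_const _).min (this.pow_const _))).ennreal_ofReal
  have hKsymm : ∀ x y, K x y = K y x := fun x y => by simp only [hK, mul_comm x y]
  have hKM : ∀ y, 0 < y → ∫⁻ x, K x y ∂μ ≤ M := fun y hy => by
    rw [hlint]
    simp only [mul_comm (d _)]
    exact hM y hy
  refine ⟨(Real.toNNReal D * ((M ^ (p - 1)) ^ (q / p) * M) ^ (1 / q)), fun f hf hadm => ?_⟩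
  set g : ℝ → ℝ≥0∞ := fun x => ENNReal.ofReal (x ^ (γ + 1 / p)) * ‖f x‖ₑ with hgdef
  have hfm : AEMeasurable f (volume.restrict (Ioi 0)) :=
    hf.1.aestronglyMeasurable_restrict_Ioi.aemeasurable
  have hg : AEMeasurable g μ := by
    refine AEMeasurable.mono_ac ?_ (withDensity_absolutelyContinuous _ _)
    exact (by fun_prop : Measurable fun x : ℝ =>
      ENNReal.ofReal (x ^ (γ + 1 / p))).aemeasurable.mul hfm.enorm
  have hschur := lintegral_schur_rpow_le (μ := μ) hKm (M := M)
    (hμae _ fun y hy => hμae _ fun x hx => by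
      rw [hK, ENNReal.ofReal_le_one]
      exact rpow_mul_struveMajorant_le_one hs0 hs1 (mul_pos hx hy))
    (hμae _ hKM) (hμae _ fun x hx => by simp only [hKsymm x]; exact hKM x hx) hp hpq hg
  have hG : ∫⁻ x, g x ^ p ∂μ = ∫⁻ x in Ioi 0, (ENNReal.ofReal (x ^ γ) * ‖f x‖ₑ) ^ p := by
    rw [hlint]
    refine setLIntegral_congr_fun measurableSet_Ioi fun x hx => ?_
    have hx0 : 0 < x := hx
    simp only [hgdef, hd]
    rw [ENNReal.mul_rpow_of_nonneg _ _ hp0.le, ENNReal.mul_rpow_of_nonneg _ _ hp0.le, ← mul_assoc,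
      ENNReal.ofReal_rpow_of_nonneg (by positivity) hp0.le,
      ENNReal.ofReal_rpow_of_nonneg (by positivity) hp0.le, ← ENNReal.ofReal_mul (by positivity),
      ← Real.rpow_mul hx0.le, ← Real.rpow_mul hx0.le, add_mul, one_div_mul_cancel hp0.ne',
      Real.rpow_add_one hx0.ne']
    congr 3
    field_simp
  have hpoint : ∀ y ∈ Ioi (0 : ℝ), (ENNReal.ofReal (y ^ (-β)) * ‖struveTransform α f y‖ₑ) ^ q ≤
      ENNReal.ofReal D ^ q * (d y * (∫⁻ x, K x y * g x ∂μ) ^ q) := by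
    intro y hy
    have hy0 : 0 < y := hy
    have h3 : ‖struveTransform α f y‖ₑ ≤ ENNReal.ofReal D *
        ∫⁻ x in Ioi 0, ENNReal.ofReal (struveMajorant α (x * y)) * ‖f x‖ₑ := by
      rw [← ofReal_norm]
      refine (ENNReal.ofReal_le_ofReal (hDf f hf hadm y hy0)).trans ?_
      rw [ENNReal.ofReal_mul hD, ofReal_integral_eq_lintegral_ofReal
        (hadm.integrableOn_majorant hf.1 hy0)
        ((ae_restrict_iff' measurableSet_Ioi).2 (ae_of_all _ fun x hx =>
          mul_nonneg (struveMajorant_nonneg α (mul_nonneg (le_of_lt hx) hy0.le))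
            (norm_nonneg _)))]
      refine mul_le_mul_right (le_of_eq ?_) _
      refine setLIntegral_congr_fun measurableSet_Ioi fun x hx => ?_
      rw [ENNReal.ofReal_mul' (norm_nonneg _), ofReal_norm]
    have h4 : ENNReal.ofReal (y ^ (-β)) *
        ∫⁻ x in Ioi 0, ENNReal.ofReal (struveMajorant α (x * y)) * ‖f x‖ₑ =
        ENNReal.ofReal (y ^ (-(1 / q))) * ∫⁻ x, K x y * g x ∂μ := by
      rw [hlint, ← lintegral_const_mul' _ _ ENNReal.ofReal_ne_top,
        ← lintegral_const_mul' _ _ ENNReal.ofReal_ne_top]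
      refine setLIntegral_congr_fun measurableSet_Ioi fun x hx => ?_
      have hx0 : 0 < x := hx
      have hk := struveMajorant_nonneg α (mul_pos hx0 hy0).le
      simp only [hd, hK, hgdef]
      simp only [← mul_assoc]
      rw [← ENNReal.ofReal_mul (by positivity), ← ENNReal.ofReal_mul (by positivity),
        ← ENNReal.ofReal_mul (by positivity), ← ENNReal.ofReal_mul (by positivity)]
      congr 2
      have e1 : x ^ (γ + 1 / p) = x ^ (-s) * x := by
        rw [← Real.rpow_add_one hx0.ne']; congr 1; linarith
      have e2 : y ^ (-β) = y ^ (-(1 / q)) * y ^ s := by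
        rw [← Real.rpow_add hy0]; congr 1; rw [hs]; ring
      have e3 : x ^ s * x ^ (-s) = 1 := by rw [← Real.rpow_add hx0]; simp
      have e4 : x⁻¹ * x = 1 := inv_mul_cancel₀ hx0.ne'
      rw [e1, e2, Real.mul_rpow hx0.le hy0.le]
      calc _ = y ^ (-(1 / q)) * y ^ s * struveMajorant α (x * y) * 1 * 1 := by ring
        _ = y ^ (-(1 / q)) * y ^ s * struveMajorant α (x * y) * (x ^ s * x ^ (-s)) *
            (x⁻¹ * x) := by rw [e3, e4]
        _ = _ := by ring
    have h5 : d y = ENNReal.ofReal (y ^ (-(1 / q))) ^ q := by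
      rw [ENNReal.ofReal_rpow_of_nonneg (by positivity) hq0.le, ← Real.rpow_mul hy0.le, neg_mul,
        one_div_mul_cancel hq0.ne', Real.rpow_neg_one]
    calc _ ≤ (ENNReal.ofReal D * (ENNReal.ofReal (y ^ (-(1 / q))) *
          ∫⁻ x, K x y * g x ∂μ)) ^ q := by
          rw [← h4, mul_left_comm]; gcongr
      _ = _ := by
          rw [ENNReal.mul_rpow_of_nonneg _ _ hq0.le, ENNReal.mul_rpow_of_nonneg _ _ hq0.le, h5]
  rw [powerNorm_eq hq0, powerNorm_eq hp0, ← hG]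
  have hinv : 1 / q * q = 1 := one_div_mul_cancel hq0.ne'
  calc _ ≤ (∫⁻ y in Ioi 0, ENNReal.ofReal D ^ q * (d y * (∫⁻ x, K x y * g x ∂μ) ^ q)) ^
        (1 / q) := by
        gcongr ?_ ^ _
        exact setLIntegral_mono_ae' measurableSet_Ioi (ae_of_all _ hpoint)
    _ = (ENNReal.ofReal D ^ q * ∫⁻ y, (∫⁻ x, K x y * g x ∂μ) ^ q ∂μ) ^ (1 / q) := by
        rw [lintegral_const_mul' _ _ (ENNReal.rpow_ne_top_of_nonneg hq0.le ENNReal.ofReal_ne_top),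
          hlint]
    _ ≤ (ENNReal.ofReal D ^ q * (((M : ℝ≥0∞) ^ (p - 1)) ^ (q / p) * M *
          (∫⁻ x, g x ^ p ∂μ) ^ (q / p))) ^ (1 / q) := by gcongr
    _ = ENNReal.ofReal D * (((M : ℝ≥0∞) ^ (p - 1)) ^ (q / p) * M) ^ (1 / q) *
          (∫⁻ x, g x ^ p ∂μ) ^ (1 / p) := by
        rw [ENNReal.mul_rpow_of_nonneg _ _ (by positivity),
          ENNReal.mul_rpow_of_nonneg _ _ (by positivity), ← ENNReal.rpow_mul, ← ENNReal.rpow_mul _ (q / p) (1 / q),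
          mul_one_div_cancel hq0.ne', ENNReal.rpow_one, ← mul_assoc]
        congr 2
        field_simp
    _ = _ := by
        rw [ENNReal.coe_mul, ENNReal.coe_rpow_of_nonneg _ (by positivity), ENNReal.coe_mul,
          ENNReal.coe_rpow_of_nonneg _ (by positivity),
          ENNReal.coe_rpow_of_nonneg _ (by linarith)]
        rfl

/-! ### Test functions -/

/-- The test function `x ^ a` on `(r, 2r]`, extended by zero. With `a = α + 1 / 2` its transform is
explicit in terms of `𝐇_{α+1}`. -/
noncomputable def cutPower (a r : ℝ) : ℝ → ℂ :=
  indicator (Ioc r (2 * r)) fun x => ((x ^ a : ℝ) : ℂ)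

theorem norm_cutPower {a r : ℝ} (hr : 0 < r) (x : ℝ) :
    ‖cutPower a r x‖ = indicator (Ioc r (2 * r)) (fun x => x ^ a) x := by
  by_cases hx : x ∈ Ioc r (2 * r)
  · have : 0 < x := hr.trans hx.1
    simp only [cutPower, indicator_of_mem hx]
    rw [Complex.norm_real, Real.norm_of_nonneg (by positivity)]
  · simp [cutPower, indicator_of_notMem hx]

/-- A monotone function whose increments dominate those of `cutPower a r`. -/
theorem exists_monotone_cutPower {a r : ℝ} (ha : 0 < a) (hr : 0 < r) :
    ∃ U : ℝ → ℝ, Monotone U ∧ (∀ x, 0 ≤ U x ∧ U x ≤ 2 * (2 * r) ^ a) ∧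
      ∀ x y, edist (cutPower a r x) (cutPower a r y) ≤ edist (U x) (U y) := by
  set U : ℝ → ℝ := fun x => if x ≤ r then 0 else if x ≤ 2 * r then x ^ a else 2 * (2 * r) ^ a with hU
  have h2r : 0 < (2 * r) ^ a := by positivity
  have hle : ∀ x, r < x → x ≤ 2 * r → x ^ a ≤ (2 * r) ^ a := fun x h1 h2 =>
    Real.rpow_le_rpow (by linarith) h2 ha.le
  have key : ∀ x y, x ≤ y → ‖cutPower a r x - cutPower a r y‖ ≤ U y - U x := by
    intro x y hxy
    by_cases hx1 : x ≤ r
    · have ex : cutPower a r x = 0 := indicator_of_notMem (fun h => absurd h.1 (not_lt.2 hx1)) _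
      rw [ex, zero_sub, norm_neg, norm_cutPower hr]
      simp only [hU, if_pos hx1, sub_zero]
      by_cases hy1 : y ≤ r
      · rw [indicator_of_notMem fun h => absurd h.1 (not_lt.2 hy1), if_pos hy1]
      · rw [if_neg hy1]
        by_cases hy2 : y ≤ 2 * r
        · rw [indicator_of_mem (show y ∈ Ioc r (2 * r) from ⟨not_le.1 hy1, hy2⟩), if_pos hy2]
        · rw [indicator_of_notMem fun h => hy2 h.2, if_neg hy2]; positivity
    · have hy1 : ¬ y ≤ r := fun h => hx1 (hxy.trans h)
      have hx0 : 0 < x := hr.trans (not_le.1 hx1)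
      by_cases hx2 : x ≤ 2 * r
      · by_cases hy2 : y ≤ 2 * r
        · simp only [hU, if_neg hx1, if_pos hx2, if_neg hy1, if_pos hy2, cutPower,
            indicator_of_mem (show x ∈ Ioc r (2 * r) from ⟨not_le.1 hx1, hx2⟩),
            indicator_of_mem (show y ∈ Ioc r (2 * r) from ⟨not_le.1 hy1, hy2⟩)]
          have : x ^ a ≤ y ^ a := by gcongr
          rw [← Complex.ofReal_sub, Complex.norm_real, Real.norm_eq_abs, abs_sub_comm,
            abs_of_nonneg (by linarith)]
        · have ey : cutPower a r y = 0 := indicator_of_notMem (fun h => hy2 h.2) _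
          rw [ey, sub_zero, norm_cutPower hr,
            indicator_of_mem (show x ∈ Ioc r (2 * r) from ⟨not_le.1 hx1, hx2⟩)]
          simp only [hU, if_neg hx1, if_pos hx2, if_neg hy1, if_neg hy2]
          linarith [hle x (not_le.1 hx1) hx2]
      · have hy2 : ¬ y ≤ 2 * r := fun h => hx2 (hxy.trans h)
        have ex : cutPower a r x = 0 := indicator_of_notMem (fun h => hx2 h.2) _
        have ey : cutPower a r y = 0 := indicator_of_notMem (fun h => hy2 h.2) _
        simp [ex, ey, hU, if_neg hx1, if_neg hx2, if_neg hy1, if_neg hy2]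
  have hmono : Monotone U := fun x y hxy => sub_nonneg.1 ((norm_nonneg _).trans (key x y hxy))
  refine ⟨U, hmono, fun x => ?_, fun x y => ?_⟩
  · simp only [hU]
    split_ifs with h1 h2
    · exact ⟨le_rfl, by positivity⟩
    · have : 0 < x := hr.trans (not_le.1 h1)
      exact ⟨by positivity, by linarith [hle x (not_le.1 h1) h2]⟩
    · exact ⟨by positivity, le_rfl⟩
  · rw [edist_dist, edist_dist, dist_eq_norm, Real.dist_eq]
    refine ENNReal.ofReal_le_ofReal ?_
    rcases le_total x y with h | h
    · rw [abs_sub_comm]; exact (key x y h).trans (le_abs_self _)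
    · rw [norm_sub_rev]; exact (key y x h).trans (le_abs_self _)

theorem eVariationOn_le_of_edist_le {f : ℝ → ℂ} {U : ℝ → ℝ}
    (h : ∀ x y, edist (f x) (f y) ≤ edist (U x) (U y)) (s : Set ℝ) :
    eVariationOn f s ≤ eVariationOn U s :=
  iSup_mono fun _ => Finset.sum_le_sum fun _ _ => h _ _

theorem locallyBoundedVariationOn_cutPower {a r : ℝ} (ha : 0 < a) (hr : 0 < r) (s : Set ℝ) :
    LocallyBoundedVariationOn (cutPower a r) s := by
  obtain ⟨U, hU, -, hd⟩ := exists_monotone_cutPower ha hr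
  intro x y hx hy
  exact ne_top_of_le_ne_top ((hU.monotoneOn s).locallyBoundedVariationOn x y hx hy)
    (eVariationOn_le_of_edist_le hd _)

/-- All the test functions `cutPower a r` are general monotone with the same constants. -/
theorem gmWith_cutPower {a r : ℝ} (ha : 0 < a) (hr : 0 < r) :
    GMWith (4 * 2 ^ a) 4 (cutPower a r) := by
  have hlbv := locallyBoundedVariationOn_cutPower ha hr (Ioi 0)
  refine ⟨hlbv, fun x hx => ?_⟩
  by_cases hcase : 2 * x ≤ r ∨ 2 * r < x
  · have h0 : ∀ t ∈ Icc x (2 * x), cutPower a r t = 0 := fun t ht => by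
      refine indicator_of_notMem (fun h => ?_) _
      rcases hcase with hc | hc
      · linarith [h.1, ht.2]
      · linarith [h.2, ht.1]
    rw [eVariationOn.constant_on]
    · exact zero_le
    · rintro _ ⟨t, ht, rfl⟩ _ ⟨u, hu, rfl⟩
      rw [h0 t ht, h0 u hu]
  · rw [not_or, not_le, not_lt] at hcase
    obtain ⟨U, hU, hb, hd⟩ := exists_monotone_cutPower ha hr
    have hvar : eVariationOn (cutPower a r) (Icc x (2 * x)) ≤ ENNReal.ofReal (2 * (2 * r) ^ a) := by
      refine (eVariationOn_le_of_edist_le hd _).trans ?_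
      have h := (hU.monotoneOn univ).eVariationOn_eq (mem_univ x) (mem_univ (2 * x))
      rw [univ_inter] at h
      rw [h]
      refine ENNReal.ofReal_le_ofReal ?_
      linarith [(hb x).1, (hb (2 * x)).2]
    refine hvar.trans (ENNReal.ofReal_le_ofReal ?_)
    have hi : IntegrableOn (fun t => ‖cutPower a r t‖) (Icc (x / 4) (4 * x)) :=
      (hlbv.integrableOn_Icc (by positivity)).norm
    have hsub : Ioc r (2 * r) ⊆ Icc (x / 4) (4 * x) := fun t ht =>
      ⟨by linarith [ht.1], by linarith [ht.2]⟩
    have h1 : ∫ _ in Ioc r (2 * r), r ^ a ≤ ∫ t in Ioc r (2 * r), ‖cutPower a r t‖ := by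
      refine setIntegral_mono_on (integrableOn_const (by simp)) (hi.mono_set hsub)
        measurableSet_Ioc fun t ht => ?_
      rw [norm_cutPower hr, indicator_of_mem ht]
      exact Real.rpow_le_rpow hr.le ht.1.le ha.le
    rw [setIntegral_const, measureReal_def, Real.volume_Ioc, ENNReal.toReal_ofReal (by linarith),
      smul_eq_mul] at h1
    have h2 := setIntegral_mono_set hi (ae_of_all _ fun _ => norm_nonneg _) hsub.eventuallyLE
    have h3 : r * r ^ a ≤ ∫ t in Icc (x / 4) (4 * x), ‖cutPower a r t‖ := by linarith
    calc 2 * (2 * r) ^ a = 4 * 2 ^ a / (2 * r) * (r * r ^ a) := by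
          rw [Real.mul_rpow (by norm_num) hr.le]; field_simp; ring
      _ ≤ _ := by gcongr; exact hcase.2

theorem integrable_rpow_mul_norm_cutPower {a r : ℝ} (ha : 0 < a) (hr : 0 < r) (s : ℝ) :
    Integrable fun x : ℝ => x ^ s * ‖cutPower a r x‖ := by
  have h := (locallyBoundedVariationOn_cutPower ha hr (Ioi 0)).integrableOn_rpow_mul_norm s
    (b := 2 * r) hr
  refine (integrableOn_iff_integrable_of_support_subset fun x hx => ?_).1 h
  by_contra hx'
  refine hx ?_
  have : cutPower a r x = 0 := indicator_of_notMem (fun h => hx' (Ioc_subset_Icc_self h)) _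
  simp [this]

theorem struveAdmissible_cutPower {a r : ℝ} (ha : 0 < a) (hr : 0 < r) (α : ℝ) :
    StruveAdmissible α (cutPower a r) :=
  ⟨(integrable_rpow_mul_norm_cutPower ha hr _).integrableOn,
    (integrable_rpow_mul_norm_cutPower ha hr _).integrableOn⟩

theorem struveTransform_cutPower {α r y : ℝ} (hα : -1 / 2 < α) (hr : 0 < r) (hy : 0 < y) :
    struveTransform α (cutPower (α + 1 / 2) r) y = ((y ^ (-(α + 3 / 2)) *
      (struvePrimitive α (2 * (r * y)) - struvePrimitive α (r * y)) : ℝ) : ℂ) := by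
  refine Tendsto.limUnder_eq (tendsto_const_nhds.congr' ?_)
  filter_upwards [eventually_ge_atTop (2 * r)] with R hR
  have e : struveIntegrand α (cutPower (α + 1 / 2) r) y = indicator (Ioc r (2 * r)) fun x =>
      ((x ^ (α + 1 / 2) * struveKernel α (x * y) : ℝ) : ℂ) := by
    ext x
    rw [struveIntegrand_eq]
    by_cases hx : x ∈ Ioc r (2 * r)
    · simp [cutPower, indicator_of_mem hx]
    · simp [cutPower, indicator_of_notMem hx]
  have hsub : Ioc 0 R ∩ Ioc r (2 * r) = Ioc r (2 * r) :=
    inter_eq_right.2 (Ioc_subset_Ioc hr.le hR)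
  have hle : r ≤ 2 * r := by linarith
  rw [e, setIntegral_indicator measurableSet_Ioc, hsub, integral_complex_ofReal]
  congr 1
  rw [← intervalIntegral.integral_of_le hle]
  have hpos : ∀ x ∈ uIcc r (2 * r), 0 < x := fun x hx => by
    rw [uIcc_of_le hle] at hx; exact hr.trans_le hx.1
  have hderiv : ∀ x ∈ uIcc r (2 * r), HasDerivAt
      (fun x => y ^ (-(α + 3 / 2)) * struvePrimitive α (x * y))
      (x ^ (α + 1 / 2) * struveKernel α (x * y)) x := by
    intro x hx
    have hx0 := hpos x hx
    have h1 := (hasDerivAt_struvePrimitive hα (mul_pos hx0 hy)).comp x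
      ((hasDerivAt_id x).mul_const y)
    convert! h1.const_mul (y ^ (-(α + 3 / 2))) using 1
    have e1 : y ^ (α + 1) * (y ^ (-(α + 3 / 2)) * y) = y ^ (1 / 2 : ℝ) := by
      rw [← Real.rpow_add_one hy.ne', ← Real.rpow_add hy]; congr 1; ring
    have e2 : x ^ (α + 1) = x ^ (α + 1 / 2) * x ^ (1 / 2 : ℝ) := by
      rw [← Real.rpow_add hx0]; congr 1; ring
    rw [struveKernel, Real.mul_rpow hx0.le hy.le, Real.mul_rpow hx0.le hy.le, e2, ← e1]
    ring
  have hc : ContinuousOn (fun x => x ^ (α + 1 / 2) * struveKernel α (x * y)) (uIcc r (2 * r)) :=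
    (ContinuousOn.rpow_const (by fun_prop) fun x hx => Or.inl (hpos x hx).ne').mul
      ((continuousOn_struveKernel hα).comp (by fun_prop) fun x hx => mul_pos (hpos x hx) hy)
  rw [intervalIntegral.integral_eq_sub_of_hasDerivAt hderiv hc.intervalIntegrable]
  rw [mul_assoc 2 r y]
  ring

/-- The norms of the test functions are at most of the order given by homogeneity in `r`. -/
theorem exists_powerNorm_cutPower_le {a p : ℝ} (hp : 0 < p) (γ : ℝ) :
    ∃ c : ℝ, 0 < c ∧ ∀ r : ℝ, 0 < r →
      powerNorm p γ (cutPower a r) ≤ ENNReal.ofReal (c * r ^ (γ + a + 1 / p)) := by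
  refine ⟨2 ^ |γ + a|, by positivity, fun r hr => ?_⟩
  have hb : ∀ x ∈ Ioi (0 : ℝ), (ENNReal.ofReal (x ^ γ) * ‖cutPower a r x‖ₑ) ^ p ≤
      indicator (Ioc r (2 * r)) (fun _ => ENNReal.ofReal (2 ^ |γ + a| * r ^ (γ + a)) ^ p) x := by
    intro x hx
    have hx0 : 0 < x := hx
    rw [← ofReal_norm, norm_cutPower hr]
    by_cases hx' : x ∈ Ioc r (2 * r)
    · rw [indicator_of_mem hx', indicator_of_mem hx', ← ENNReal.ofReal_mul (by positivity),
        ← Real.rpow_add hx0]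
      gcongr
      have h := Real.rpow_le_rpow_abs (u := x / r) (L := 2) (by positivity)
        (by rw [le_div_iff₀ hr]; linarith [hx'.1]) (by rw [div_le_iff₀ hr]; exact hx'.2) (γ + a)
      rwa [Real.div_rpow hx0.le hr.le, div_le_iff₀ (by positivity)] at h
    · rw [indicator_of_notMem hx', indicator_of_notMem hx']
      simp [hp]
  rw [powerNorm_eq hp]
  calc _ ≤ (∫⁻ x in Ioi 0, indicator (Ioc r (2 * r))
          (fun _ => ENNReal.ofReal (2 ^ |γ + a| * r ^ (γ + a)) ^ p) x) ^ (1 / p) := by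
        gcongr ?_ ^ _
        exact setLIntegral_mono_ae' measurableSet_Ioi (ae_of_all _ hb)
    _ ≤ (∫⁻ x, indicator (Ioc r (2 * r))
          (fun _ => ENNReal.ofReal (2 ^ |γ + a| * r ^ (γ + a)) ^ p) x) ^ (1 / p) := by
        gcongr ?_ ^ _
        exact setLIntegral_le_lintegral _ _
    _ = (ENNReal.ofReal (2 ^ |γ + a| * r ^ (γ + a)) ^ p * ENNReal.ofReal r) ^ (1 / p) := by
        rw [lintegral_indicator_const measurableSet_Ioc, Real.volume_Ioc]
        congr 3; ring
    _ = _ := by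
        rw [ENNReal.mul_rpow_of_nonneg _ _ (by positivity), ← ENNReal.rpow_mul,
          mul_one_div_cancel hp.ne', ENNReal.rpow_one,
          ENNReal.ofReal_rpow_of_nonneg hr.le (by positivity), ← ENNReal.ofReal_mul (by positivity),
          mul_assoc, ← Real.rpow_add hr]

/-! ### Necessity of the conditions -/

theorem lintegral_le_powerNorm_rpow {q s : ℝ} (hq : 0 < q) (g : ℝ → ℂ) {S : Set ℝ}
    (hS : S ⊆ Ioi 0) :
    ∫⁻ x in S, (ENNReal.ofReal (x ^ s) * ‖g x‖ₑ) ^ q ≤ powerNorm q s g ^ q := by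
  rw [powerNorm_eq hq, ← ENNReal.rpow_mul, one_div_mul_cancel hq.ne', ENNReal.rpow_one]
  exact lintegral_mono_set hS

/-- A function of finite norm can dominate a power only where the `q`-th power of that power is
integrable. -/
theorem integrableOn_rpow_of_powerNorm_lt_top {q s : ℝ} (hq : 0 < q) {g : ℝ → ℂ} {S : Set ℝ}
    (hS : S ⊆ Ioi 0) (hSm : MeasurableSet S) (hfin : powerNorm q s g < ∞) {c e : ℝ} (hc : 0 < c)
    (h : ∀ x ∈ S, c * x ^ e ≤ x ^ s * ‖g x‖) : IntegrableOn (fun x : ℝ => x ^ (e * q)) S := by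
  have h1 : ∫⁻ x in S, ENNReal.ofReal (c ^ q * x ^ (e * q)) ≤ powerNorm q s g ^ q := by
    refine (setLIntegral_mono_ae' hSm (ae_of_all _ fun x hx => ?_)).trans
      (lintegral_le_powerNorm_rpow hq g hS)
    have hx0 : 0 < x := hS hx
    rw [← ofReal_norm, ← ENNReal.ofReal_mul (by positivity),
      ENNReal.ofReal_rpow_of_nonneg (by positivity) hq.le, Real.rpow_mul hx0.le,
      ← Real.mul_rpow hc.le (by positivity)]
    refine ENNReal.ofReal_le_ofReal (Real.rpow_le_rpow (by positivity) (h x hx) hq.le)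
  have h2 := (lintegral_ofReal_ne_top_iff_integrable (μ := volume.restrict S)
    (f := fun x => c ^ q * x ^ (e * q)) (by fun_prop)
    ((ae_restrict_iff' hSm).2 (ae_of_all _ fun x hx => by
      have : 0 < x := hS hx
      positivity))).1 (ne_top_of_le_ne_top (ENNReal.rpow_ne_top_of_nonneg hq.le hfin.ne) h1)
  have h3 := h2.const_mul (c ^ q)⁻¹
  refine h3.congr (ae_of_all _ fun x => ?_)
  have : c ^ q ≠ 0 := by positivity
  field_simp

theorem eq_zero_of_forall_rpow_le {e B : ℝ} (h : ∀ r : ℝ, 0 < r → r ^ e ≤ B) : e = 0 := by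
  have key : ∀ e : ℝ, (∀ r : ℝ, 0 < r → r ^ e ≤ B) → ¬ 0 < e := fun e h he => by
    obtain ⟨r, hr, hr0⟩ := (((tendsto_rpow_atTop he).eventually_gt_atTop B).and
      (eventually_gt_atTop 0)).exists
    exact absurd (h r hr0) (not_le.2 hr)
  refine le_antisymm (not_lt.1 (key e h)) (not_lt.1 fun he => key (-e) (fun r hr => ?_) (by linarith))
  have := h r⁻¹ (inv_pos.2 hr)
  rwa [Real.inv_rpow hr.le, ← Real.rpow_neg hr.le] at this

/-- The norms of the transforms of the test functions are at least of the order given by homogeneity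
in `r`; only the values for `ry` in a fixed interval near `0` are used. -/
theorem exists_le_powerNorm_struveTransform_cutPower {α q : ℝ} (hα : -1 / 2 < α) (hq : 0 < q)
    (β : ℝ) : ∃ c : ℝ, 0 < c ∧ ∀ r : ℝ, 0 < r → ENNReal.ofReal (c * r ^ (β + α + 3 / 2 - 1 / q)) ≤
      powerNorm q (-β) (struveTransform α (cutPower (α + 1 / 2) r)) := by
  obtain ⟨c, T, hc, hT, h⟩ := exists_le_struvePrimitive_sub_zero hα
  set e : ℝ := -(β + α + 3 / 2) with he
  set m : ℝ := (2 ^ |e|)⁻¹ * T ^ e * (c * (T / 2) ^ (2 * α + 3)) with hm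
  refine ⟨m * (T / 2) ^ (1 / q), by positivity, fun r hr => ?_⟩
  have hb : ∀ y ∈ Ioc (T / 2 / r) (T / r), ENNReal.ofReal (m * r ^ (-e)) ^ q ≤
      (ENNReal.ofReal (y ^ (-β)) * ‖struveTransform α (cutPower (α + 1 / 2) r) y‖ₑ) ^ q := by
    intro y hy
    have hy0 : 0 < y := lt_trans (by positivity) hy.1
    have h1 : T / 2 ≤ r * y := (div_le_iff₀' hr).1 hy.1.le
    have h2 : r * y ≤ T := (le_div_iff₀' hr).1 hy.2
    have h3 := h (r * y) (by positivity) h2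
    have h4 : c * (T / 2) ^ (2 * α + 3) ≤ c * (r * y) ^ (2 * α + 3) := by
      have : 0 ≤ 2 * α + 3 := by linarith
      gcongr
    have h5 : ((T / r) / y) ^ e ≤ 2 ^ |e| := by
      refine Real.rpow_le_rpow_abs (by positivity) ?_ ?_ _
      · rw [le_div_iff₀ hy0, le_div_iff₀ hr]; nlinarith
      · rw [div_le_iff₀ hy0, div_le_iff₀ hr]; nlinarith
    rw [Real.div_rpow (by positivity) hy0.le, div_le_iff₀ (by positivity),
      Real.div_rpow hT.le hr.le, ← inv_mul_le_iff₀ (by positivity)] at h5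
    rw [struveTransform_cutPower hα hr hy0, ← ofReal_norm, Complex.norm_real,
      ← ENNReal.ofReal_mul (by positivity)]
    refine ENNReal.rpow_le_rpow (ENNReal.ofReal_le_ofReal ?_) hq.le
    rw [norm_mul, Real.norm_of_nonneg (by positivity : 0 ≤ y ^ (-(α + 3 / 2))), ← mul_assoc,
      ← Real.rpow_add hy0, show -β + -(α + 3 / 2) = e by rw [he]; ring]
    calc m * r ^ (-e) = ((2 ^ |e|)⁻¹ * (T ^ e / r ^ e)) * (c * (T / 2) ^ (2 * α + 3)) := by
          rw [hm, Real.rpow_neg hr.le]; ring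
      _ ≤ y ^ e * ‖struvePrimitive α (2 * (r * y)) - struvePrimitive α (r * y)‖ := by
          gcongr
          exact (h4.trans h3).trans (le_abs_self _)
  have hsub : Ioc (T / 2 / r) (T / r) ⊆ Ioi 0 := fun y hy => lt_trans (by positivity) hy.1
  have h6 := (setLIntegral_mono_ae' measurableSet_Ioc (ae_of_all _ hb)).trans
    (lintegral_le_powerNorm_rpow hq _ hsub)
  rw [setLIntegral_const, Real.volume_Ioc, show T / r - T / 2 / r = T / 2 / r by ring] at h6
  have h7 := ENNReal.rpow_le_rpow h6 (by positivity : 0 ≤ 1 / q)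
  rw [← ENNReal.rpow_mul, mul_one_div_cancel hq.ne', ENNReal.rpow_one,
    ENNReal.mul_rpow_of_nonneg _ _ (by positivity), ← ENNReal.rpow_mul, mul_one_div_cancel hq.ne',
    ENNReal.rpow_one, ENNReal.ofReal_rpow_of_nonneg (by positivity) (by positivity),
    ← ENNReal.ofReal_mul (by positivity), Real.div_rpow (by positivity) hr.le] at h7
  refine le_trans (le_of_eq ?_) h7
  congr 1
  have e1 : r ^ (β + α + 3 / 2 - 1 / q) = r ^ (-e) / r ^ (1 / q) := by
    rw [← Real.rpow_sub hr]; congr 1; rw [he]; ring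
  rw [e1]; ring

/-- The necessity of the conditions on `β` and `γ`. -/
theorem struve_inequality_necessary {α p q β γ : ℝ} (hα : -1 / 2 < α) (hp : 1 < p) (hpq : p ≤ q)
    (H : ∀ C lam : ℝ, 1 < C → 1 < lam →
        ∃ A : ℝ≥0, ∀ f : ℝ → ℂ, GMWith C lam f → StruveAdmissible α f →
          powerNorm q (-β) (struveTransform α f) ≤ (A : ℝ≥0∞) * powerNorm p γ f) :
    β = γ + 1 / q - 1 / Real.conjExponent p ∧
        1 / q + α - 1 / 2 < β ∧ β < 1 / q + α + 3 / 2 := by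
  have hp0 : 0 < p := by linarith
  have hq0 : 0 < q := by linarith
  have ha : 0 < α + 1 / 2 := by linarith
  obtain ⟨A, hA⟩ := H (4 * 2 ^ (α + 1 / 2)) 4
    (by have := Real.one_le_rpow one_le_two ha.le; linarith) (by norm_num)
  obtain ⟨c, hc, hupper⟩ := exists_powerNorm_cutPower_le (a := α + 1 / 2) hp0 γ
  obtain ⟨m, hm, hlower⟩ := exists_le_powerNorm_struveTransform_cutPower hα hq0 β
  have hineq : ∀ r : ℝ, 0 < r →
      powerNorm q (-β) (struveTransform α (cutPower (α + 1 / 2) r)) ≤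
        ENNReal.ofReal (A * (c * r ^ (γ + (α + 1 / 2) + 1 / p))) := fun r hr => by
    refine (hA _ (gmWith_cutPower ha hr) (struveAdmissible_cutPower ha hr α)).trans ?_
    rw [ENNReal.ofReal_mul A.coe_nonneg, ENNReal.ofReal_coe_nnreal]
    gcongr
    exact hupper r hr
  refine ⟨?_, ?_⟩
  -- the exponents of homogeneity of the two sides agree
  · have h1 : (β + α + 3 / 2 - 1 / q) - (γ + (α + 1 / 2) + 1 / p) = 0 := by
      refine eq_zero_of_forall_rpow_le (B := A * c / m) fun r hr => ?_
      have h2 := (hlower r hr).trans (hineq r hr)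
      rw [ENNReal.ofReal_le_ofReal_iff (by positivity)] at h2
      rw [Real.rpow_sub hr, div_le_div_iff₀ (by positivity) hm]
      linarith
    have h3 := (Real.HolderConjugate.conjExponent hp).inv_add_inv_eq_one
    rw [← one_div, ← one_div] at h3
    linarith
  · have hfin := (hineq 1 one_pos).trans_lt ENNReal.ofReal_lt_top
    have hval : ∀ y : ℝ, 0 < y → ∀ c e : ℝ, c * y ^ e ≤
        struvePrimitive α (2 * y) - struvePrimitive α y → c * y ^ (-(β + α + 3 / 2) + e) ≤
        y ^ (-β) * ‖struveTransform α (cutPower (α + 1 / 2) 1) y‖ := fun y hy c e h => by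
      rw [struveTransform_cutPower hα one_pos hy, one_mul, Complex.norm_real, norm_mul,
        Real.norm_of_nonneg (by positivity : 0 ≤ y ^ (-(α + 3 / 2))), ← mul_assoc,
        ← Real.rpow_add hy, Real.rpow_add hy, show -β + -(α + 3 / 2) = -(β + α + 3 / 2) by ring]
      calc _ = y ^ (-(β + α + 3 / 2)) * (c * y ^ e) := by ring
        _ ≤ _ := by
          gcongr
          exact h.trans (le_abs_self _)
    constructor
    · obtain ⟨c, T, hc, hT, h⟩ := exists_le_struvePrimitive_sub_atTop hα
      have h1 := integrableOn_rpow_of_powerNorm_lt_top hq0 (S := Ioi T)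
        (Ioi_subset_Ioi hT.le) measurableSet_Ioi hfin hc
        fun y hy => hval y (hT.trans hy) c _ (h y (le_of_lt hy))
      rw [integrableOn_Ioi_rpow_iff hT, ← lt_div_iff₀ hq0, neg_div] at h1
      linarith
    · obtain ⟨c, T, hc, hT, h⟩ := exists_le_struvePrimitive_sub_zero hα
      have h1 := integrableOn_rpow_of_powerNorm_lt_top hq0 (S := Ioo 0 T)
        (fun y hy => hy.1) measurableSet_Ioo hfin hc
        fun y hy => hval y hy.1 c _ (h y hy.1 hy.2.le)
      rw [intervalIntegral.integrableOn_Ioo_rpow_iff hT, ← div_lt_iff₀ hq0, neg_div] at h1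
      linarith

theorem mainTheorem12 (α p q β γ : ℝ) (hα : -1 / 2 < α) (hp : 1 < p) (hpq : p ≤ q) :
    (∀ f : ℝ → ℂ, IsGM f → StruveAdmissible α f → ∀ y : ℝ, 0 < y → StruveConverges α f y) ∧
    ((∀ C lam : ℝ, 1 < C → 1 < lam →
        ∃ A : ℝ≥0, ∀ f : ℝ → ℂ, GMWith C lam f → StruveAdmissible α f →
          powerNorm q (-β) (struveTransform α f) ≤ (A : ℝ≥0∞) * powerNorm p γ f) ↔
      (β = γ + 1 / q - 1 / Real.conjExponent p ∧
        1 / q + α - 1 / 2 < β ∧ β < 1 / q + α + 3 / 2)) := by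
  refine ⟨?_, struve_inequality_necessary hα hp hpq, ?_⟩
  · rintro f ⟨C, lam, hC, hlam, hf⟩ hadm y hy
    exact hf.struveConverges hα (by linarith) (by linarith) hadm hy
  · rintro ⟨hβ, h1, h2⟩ C lam hC hlam
    exact exists_powerNorm_struveTransform_le hα hp hpq hβ h1 h2 (by linarith) (by linarith)
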